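/- Let $M$ and $N$ be compact connected oriented $n$-dimensional smooth manifolds without boundary embedded in $\mathbb R^{n+1}$. A $C^2$ morph from $M$ to $N$ is a $C^2$ map $H:[0,1]\times M\to\mathbb R^{n+1}$ such that, with $h^t:=H(t,\cdot)$ and $M^t:=h^t(M)$: each $h^t$ is a $C^2$ diffeomorphism of $M$ onto $M^t$; each $M^t$ is again a compact connected oriented $n$-dimensional smooth embedded manifold without boundary; $h^0$ is a $C^2$ diffeomorphism of $M$ onto $M$; and $M^1=N$. Every such manifold $K$ carries the volume form $\omega_K=i_{\eta}\Omega$, where $\Omega=dx_1\wedge\dots\wedge dx_{n+1}$ and $\eta$ is the outer unit normal of $K$, and $\operatorname{Vol}(K)=\int_K\omega_K$. For a $C^2$ diffeomorphism $h:K\to L$ of such manifolds, the Jacobian $J(h)$ is defined by $h^*\omega_L=J(h)\,\omega_K$, and the total distortion of $h$ is $$\Phi_{K,L}(h)=\int_K\big(|J(h)|-1\big)^2\,\omega_K .$$ The map $h$ is called distortion minimal if it is a critical point of $\Phi_{K,L}$ on the $C^2$ diffeomorphisms from $K$ to $L$, i.e. $\frac{d}{d\varepsilon}\Phi_{K,L}(h_\varepsilon)\big|_{\varepsilon=0}=0$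 for every family $(h_\varepsilon)_{\varepsilon\in(-1,1)}$ of $C^2$ diffeomorphisms from $K$ to $L$ with $h_0=h$ that is $C^2$ jointly in $\varepsilon$ and the point. The morph $H$ is pairwise minimal if the map $h^{s,t}:=h^t\circ(h^s)^{-1}:M^s\to M^t$ is distortion minimal for all $s,t\in[0,1]$. Let $E_{s,t}:=\Phi_{M^s,M^t}(h^{s,t})$. The infinitesimal distortion of $H$ at $t\in[0,1]$ is $\varepsilon^H(t)=\lim_{s\to t}E_{s,t}/(s-t)^2$ (with $s\in[0,1]$, $s\neq t$), and the total distortion of $H$ is $\Phi(H)=\int_0^1\varepsilon^H(t)\,dt$. Let $H$ be a $C^2$ pairwise minimal morph from $M$ to $N$. Then, for every $t\in[0,1]$, the limit $\varepsilon^H(t)$ exists and $$\varepsilon^H(t)=\int_M\frac{\big(\frac{d}{dt}|J(h^t)|\big)^2}{|J(h^t)|}\,\omega_M ;$$ the function $\varepsilon^H$ is integrable on $[0,1]$; the function $t\mapsto\operatorname{Vol}(M^t)$ is positive and $C^1$ on $[0,1]$; and $$\Phi(H)=\int_0^1\frac{\big(\frac{d}{dt}\operatorname{Vol}(M^t)\big)^2}{\operatorname{Vol}(M^t)}\,dt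 .$$ (Derivatives with respect to $t$ at the endpoints of $[0,1]$ are one-sided.) -/

import Mathlib

open Set Filter Topology MeasureTheory
open scoped ContDiff

noncomputable section

namespace Morphing

/-- Euclidean space `ℝᵏ`. -/
abbrev Eu (k : ℕ) : Type := EuclideanSpace ℝ (Fin k)

/-! ### Closed hypersurfaces of `ℝⁿ⁺¹` -/

/-- `φ`, restricted to the open set `U ⊆ ℝⁿ`, is a smooth local parametrization of
`M ⊆ ℝⁿ⁺¹`: a smooth immersion that is a homeomorphism of `U` onto an open subset of `M`. -/
structure IsLocalParam {n : ℕ} (M : Set (Eu (n + 1))) (φ : Eu n → Eu (n + 1))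
    (U : Set (Eu n)) : Prop where
  isOpen : IsOpen U
  contDiffOn : ContDiffOn ℝ ∞ φ U
  immersion : ∀ x ∈ U, Function.Injective (fderiv ℝ φ x)
  injOn : InjOn φ U
  open_image : ∀ W ⊆ U, IsOpen W → ∃ V, IsOpen V ∧ φ '' W = M ∩ V

/-- `M` is a compact connected `n`-dimensional smooth manifold without boundary, embedded in
`ℝⁿ⁺¹` (`IsConnected` includes that `M` is nonempty). -/
structure IsClosedHypersurface {n : ℕ} (M : Set (Eu (n + 1))) : Prop where
  isCompact : IsCompact M
  isConnected : IsConnected M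
  exists_param : ∀ p ∈ M, ∃ φ U, IsLocalParam M φ U ∧ p ∈ φ '' U

/-! ### Outer unit normal and volume form

For an embedded submanifold `M`, `tangentConeAt ℝ M p` is the tangent space of `M` at `p`. -/

/-- `v` is a unit normal vector of `M` at `p`. -/
def IsUnitNormal {n : ℕ} (M : Set (Eu (n + 1))) (p v : Eu (n + 1)) : Prop :=
  ‖v‖ = 1 ∧ ∀ w ∈ tangentConeAt ℝ M p, inner ℝ v w = 0

/-- `v`, attached at `p`, points out of `M`: moving a little from `p` in the direction `v` one is
in an unbounded connected component of the complement of `M`. -/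
def PointsOutward {n : ℕ} (M : Set (Eu (n + 1))) (p v : Eu (n + 1)) : Prop :=
  ∀ᶠ r : ℝ in 𝓝[>] 0, p + r • v ∈ Mᶜ ∧
    ¬ Bornology.IsBounded (connectedComponentIn Mᶜ (p + r • v))

open Classical in
/-- The outer unit normal `η` of `M` at `p`. (By the Jordan-Brouwer theorem the first case always
occurs for a closed hypersurface of dimension `n ≥ 1`; the second case only makes the definition
total, and there any unit normal is taken.) -/
def outerNormal {n : ℕ} (M : Set (Eu (n + 1))) (p : Eu (n + 1)) : Eu (n + 1) :=
  if h : ∃ v, IsUnitNormal M p v ∧ PointsOutward M p v then h.choose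
  else Classical.epsilon (IsUnitNormal M p)

/-- The standard volume form `Ω = dx₁ ∧ … ∧ dxₙ₊₁` of `ℝⁿ⁺¹`. -/
def stdForm (n : ℕ) : (Eu (n + 1)) [⋀^Fin (n + 1)]→ₗ[ℝ] ℝ :=
  (EuclideanSpace.basisFun (Fin (n + 1)) ℝ).toBasis.det

/-- The volume form `ω = i_η Ω` of the hypersurface `M` at the point `p`. -/
def volForm {n : ℕ} (M : Set (Eu (n + 1))) (p : Eu (n + 1)) :
    (Eu (n + 1)) [⋀^Fin n]→ₗ[ℝ] ℝ :=
  (stdForm n).curryLeft (outerNormal M p)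

/-- The measure that the volume form of `M` induces on the image of a parametrization `φ`:
`φ(A)` has measure `∫_A |ω(∂₁φ, …, ∂ₙφ)| dx` for measurable `A ⊆ U`. -/
def paramMeasure {n : ℕ} (M : Set (Eu (n + 1))) (φ : Eu n → Eu (n + 1)) (U : Set (Eu n)) :
    Measure (Eu (n + 1)) :=
  ((volume.restrict U).withDensity fun x =>
    ENNReal.ofReal |volForm M (φ x) fun i => fderiv ℝ φ x (EuclideanSpace.single i 1)|).map φ

/-- The measure on `M` (regarded as a measure on `ℝⁿ⁺¹` carried by `M`) given by integration of
the volume form over `M`, oriented by that form. It is the measure whose restriction to the image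
of each local parametrization `φ` is `paramMeasure M φ U`, which is the least upper bound
of all these measures because they agree on overlaps. -/
def volMeasure {n : ℕ} (M : Set (Eu (n + 1))) : Measure (Eu (n + 1)) :=
  ⨆ (φ : Eu n → Eu (n + 1)) (U : Set (Eu n)) (_ : IsLocalParam M φ U), paramMeasure M φ U

/-- The volume `Vol(M) = ∫_M ω`. -/
def Vol {n : ℕ} (M : Set (Eu (n + 1))) : ℝ := (volMeasure M).real univ

/-! ### Diffeomorphisms, Jacobian, distortion

For an embedded submanifold `M` and a map `h` defined on it, `ContDiffOn ℝ k h M` is the usual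
notion of a `C^k` map on `M`, and `fderivWithin ℝ h M p` is, on tangent vectors of `M` at `p`,
the usual differential (its values on other vectors are arbitrary and never used). -/

/-- `h` is a `C^k` diffeomorphism from `M` onto `N`. Only the values of `h` on `M` matter. -/
def IsDiffeo {n : ℕ} (k : WithTop ℕ∞) (M N : Set (Eu (n + 1)))
    (h : Eu (n + 1) → Eu (n + 1)) : Prop :=
  ContDiffOn ℝ k h M ∧ MapsTo h M N ∧
    ∃ g : Eu (n + 1) → Eu (n + 1), ContDiffOn ℝ k g N ∧ MapsTo g N M ∧ InvOn g h M N

/-- The Jacobian `J(h)(p)` of `h : M → N`: the number `c` with `(h^* ω_N)_p = c • (ω_M)_p` on the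
tangent space of `M` at `p`. -/
def jacobian {n : ℕ} (M N : Set (Eu (n + 1))) (h : Eu (n + 1) → Eu (n + 1))
    (p : Eu (n + 1)) : ℝ :=
  Classical.epsilon fun c : ℝ => ∀ v : Fin n → Eu (n + 1), (∀ i, v i ∈ tangentConeAt ℝ M p) →
    volForm N (h p) (fun i => fderivWithin ℝ h M p (v i)) = c * volForm M p v

/-- The total distortion `∫_M (|J(h)| - 1)² ω_M` of a diffeomorphism `h : M → N`. -/
def mapDistortion {n : ℕ} (M N : Set (Eu (n + 1))) (h : Eu (n + 1) → Eu (n + 1)) : ℝ :=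
  ∫ p, (|jacobian M N h p| - 1) ^ 2 ∂(volMeasure M)

/-- `c` is a curve `ε ↦ c ε`, `ε ∈ (-1, 1)`, of `C²` diffeomorphisms from `M` to `N` that passes
through `h` at `ε = 0` and is `C²` in both variables. -/
structure IsVariation {n : ℕ} (M N : Set (Eu (n + 1))) (h : Eu (n + 1) → Eu (n + 1))
    (c : ℝ → Eu (n + 1) → Eu (n + 1)) : Prop where
  isDiffeo : ∀ ε ∈ Ioo (-1 : ℝ) 1, IsDiffeo 2 M N (c ε)
  apply_zero : ∀ p ∈ M, c 0 p = h p
  contDiffOn : ContDiffOn ℝ 2 (fun q : ℝ × Eu (n + 1) => c q.1 q.2) (Ioo (-1 : ℝ) 1 ×ˢ M)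

/-- `h` is a distortion minimal map: a `C²` diffeomorphism from `M` to `N` that is a critical
point of the total distortion functional on the `C²` diffeomorphisms from `M` to `N`. -/
def IsDistortionMinimalMap {n : ℕ} (M N : Set (Eu (n + 1)))
    (h : Eu (n + 1) → Eu (n + 1)) : Prop :=
  IsDiffeo 2 M N h ∧
    ∀ c, IsVariation M N h c → HasDerivAt (fun ε => mapDistortion M N (c ε)) 0 0

/-! ### Morphs -/

/-- `H` is a `C^k` morph from `M` to `N`; only its values on `[0,1] × M` matter. -/
structure IsMorph {n : ℕ} (k : WithTop ℕ∞) (M N : Set (Eu (n + 1)))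
    (H : ℝ → Eu (n + 1) → Eu (n + 1)) : Prop where
  contDiffOn : ContDiffOn ℝ k (fun q : ℝ × Eu (n + 1) => H q.1 q.2) (Icc (0 : ℝ) 1 ×ˢ M)
  isDiffeo : ∀ t ∈ Icc (0 : ℝ) 1, IsDiffeo k M (H t '' M) (H t)
  isClosedHypersurface : ∀ t ∈ Icc (0 : ℝ) 1, IsClosedHypersurface (H t '' M)
  isDiffeo_zero : IsDiffeo k M M (H 0)
  image_one : H 1 '' M = N

/-- The transition map `h^{s,t} = h^t ∘ (h^s)⁻¹ : M^s → M^t`, where `h^t = H(t, ·)` and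
`M^t = H(t, M)`. -/
def transition {n : ℕ} (M : Set (Eu (n + 1))) (H : ℝ → Eu (n + 1) → Eu (n + 1)) (s t : ℝ) :
    Eu (n + 1) → Eu (n + 1) :=
  fun q => H t (Function.invFunOn (H s) M q)

/-- All transition maps of the morph are distortion minimal maps. -/
def IsPairwiseMinimal {n : ℕ} (M : Set (Eu (n + 1)))
    (H : ℝ → Eu (n + 1) → Eu (n + 1)) : Prop :=
  ∀ s ∈ Icc (0 : ℝ) 1, ∀ t ∈ Icc (0 : ℝ) 1,
    IsDistortionMinimalMap (H s '' M) (H t '' M) (transition M H s t)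

/-- `E_{s,t}`, the total distortion of the transition map `h^{s,t} : M^s → M^t`. -/
def transitionDistortion {n : ℕ} (M : Set (Eu (n + 1)))
    (H : ℝ → Eu (n + 1) → Eu (n + 1)) (s t : ℝ) : ℝ :=
  mapDistortion (H s '' M) (H t '' M) (transition M H s t)

/-- The infinitesimal distortion `ε^H(t) = lim_{s → t} E_{s,t} / (s - t)²`, with `s ∈ [0,1]`,
`s ≠ t`. -/
def infinitesimalDistortion {n : ℕ} (M : Set (Eu (n + 1)))
    (H : ℝ → Eu (n + 1) → Eu (n + 1)) (t : ℝ) : ℝ :=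
  limUnder (𝓝[Icc (0 : ℝ) 1 \ {t}] t) fun s => transitionDistortion M H s t / (s - t) ^ 2

/-- The total distortion `Φ(H) = ∫₀¹ ε^H(t) dt` of a morph. -/
def totalDistortion {n : ℕ} (M : Set (Eu (n + 1)))
    (H : ℝ → Eu (n + 1) → Eu (n + 1)) : ℝ :=
  ∫ t in (0 : ℝ)..1, infinitesimalDistortion M H t

end Morphing

end

/-! The core fact is that a distortion minimal map `k : M → N` has Jacobian of constant absolute
value (`IsDistortionMinimalMap.exists_abs_jacobian_eq`). Criticality is tested on variations `k ∘ φ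
∘ (id + ε χ v) ∘ φ⁻¹` supported in one chart `φ`. With `g` and `ρ` the volume densities of `k ∘ φ`
and `φ`, so that `|J(k)| = g/ρ`, the first variation is `∫ 2 (g/ρ - 1) ∂ᵥ(g χ)`. Integration by
parts gives `∫ χ g ∂ᵥ(g/ρ) = 0` for all bumps `χ` and directions `v`. Since `g > 0`, `g/ρ` is
locally constant, hence constant because `M` is connected. By change of variables
(`IsDiffeo.Vol_eq_integral`) the constant is `Vol N / Vol M`, and the distortion is `(Vol N - Vol
M)² / Vol M`.

For a pairwise minimal morph put `V(t) = Vol(M^t)`. Then `E_{s,t} = (V(t) - V(s))² / V(s)`, and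
dividing by `(s - t)²` gives the limit `V'(t)² / V(t)`. Constancy also yields `|J(h^t)| = |J(h^0)|
V(t) / V(0)` pointwise. Thus `V` is `C¹` because the density at one single point is, and the
integral over `M` collapses to `V'² / V`.

The measure theory reduces the supremum `volMeasure` to chart integrals of the Gram density
`volFactor` (`IsDissection.volMeasure_apply`). That density is the same for every choice of unit
normal, so orientation plays no role and only `|J|` occurs. -/

noncomputable section

namespace Morphing

/-! ### The volume factor of a linear map -/

/-- The matrix of a linear map between Euclidean spaces. -/
def jacMatrix {m k : ℕ} (L : Eu m →L[ℝ] Eu k) : Matrix (Fin k) (Fin m) ℝ :=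
  Matrix.of fun j i => L (EuclideanSpace.single i 1) j

/-- The factor `√det(LᵀL)` by which a linear map `ℝᵐ → ℝᵏ` scales `m`-dimensional volume. -/
def volFactor {m k : ℕ} (L : Eu m →L[ℝ] Eu k) : ℝ :=
  √((jacMatrix L).transpose * jacMatrix L).det

lemma jacMatrix_eq_toMatrix {m k : ℕ} (L : Eu m →L[ℝ] Eu k) :
    jacMatrix L = LinearMap.toMatrix (EuclideanSpace.basisFun (Fin m) ℝ).toBasis
      (EuclideanSpace.basisFun (Fin k) ℝ).toBasis (L : Eu m →ₗ[ℝ] Eu k) := by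
  ext j i
  simp [jacMatrix, LinearMap.toMatrix_apply]

lemma jacMatrix_comp {l m k : ℕ} (L : Eu m →L[ℝ] Eu k) (A : Eu l →L[ℝ] Eu m) :
    jacMatrix (L.comp A) = jacMatrix L * jacMatrix A := by
  simp only [jacMatrix_eq_toMatrix]
  exact LinearMap.toMatrix_comp _ _ _ _ _

lemma det_jacMatrix {m : ℕ} (A : Eu m →L[ℝ] Eu m) : (jacMatrix A).det = A.det := by
  rw [jacMatrix_eq_toMatrix, LinearMap.det_toMatrix]

lemma jacMatrix_mulVec {m k : ℕ} (L : Eu m →L[ℝ] Eu k) (v : Fin m → ℝ) :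
    (jacMatrix L).mulVec v = (L (WithLp.toLp 2 v)).ofLp := by
  have h := LinearMap.toMatrix_mulVec_repr (EuclideanSpace.basisFun (Fin m) ℝ).toBasis
      (EuclideanSpace.basisFun (Fin k) ℝ).toBasis (L : Eu m →ₗ[ℝ] Eu k) (WithLp.toLp 2 v)
  rw [← jacMatrix_eq_toMatrix] at h
  have hv : ⇑((EuclideanSpace.basisFun (Fin m) ℝ).toBasis.repr (WithLp.toLp 2 v)) = v := by
    ext i; simp
  rw [hv] at h
  ext j
  simpa using congrFun h j

lemma volFactor_nonneg {m k : ℕ} (L : Eu m →L[ℝ] Eu k) : 0 ≤ volFactor L := Real.sqrt_nonneg _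

lemma det_gram_pos {m k : ℕ} {L : Eu m →L[ℝ] Eu k} (hL : Function.Injective L) :
    0 < ((jacMatrix L).transpose * jacMatrix L).det := by
  have h : Function.Injective (jacMatrix L).mulVec := by
    intro v w hvw
    simp only [jacMatrix_mulVec] at hvw
    have := hL (WithLp.ofLp_injective 2 hvw)
    exact WithLp.toLp_injective 2 this
  have := (Matrix.PosDef.conjTranspose_mul_self _ h).det_pos
  simpa using this

lemma volFactor_pos {m k : ℕ} {L : Eu m →L[ℝ] Eu k} (hL : Function.Injective L) :
    0 < volFactor L := Real.sqrt_pos.2 (det_gram_pos hL)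

/-- The Gram matrix becomes `Aᵀ(LᵀL)A`. This rule gives both the independence of charts and the
effect of a variation on the density. -/
lemma volFactor_comp {m k : ℕ} (L : Eu m →L[ℝ] Eu k) (A : Eu m →L[ℝ] Eu m) :
    volFactor (L.comp A) = volFactor L * |A.det| := by
  have : ((jacMatrix (L.comp A)).transpose * jacMatrix (L.comp A)).det
      = ((jacMatrix L).transpose * jacMatrix L).det * A.det ^ 2 := by
    rw [jacMatrix_comp, Matrix.transpose_mul, Matrix.mul_assoc, ← Matrix.mul_assoc _ _ (jacMatrix A),
      Matrix.det_mul, Matrix.det_mul, Matrix.det_transpose, det_jacMatrix]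
    ring
  rw [volFactor, this, Real.sqrt_mul' _ (sq_nonneg _), Real.sqrt_sq_eq_abs, volFactor]

lemma contDiff_det_gram {m k : ℕ} {r : WithTop ℕ∞} :
    ContDiff ℝ r fun L : Eu m →L[ℝ] Eu k => ((jacMatrix L).transpose * jacMatrix L).det := by
  have h : ∀ j i, ContDiff ℝ r fun L : Eu m →L[ℝ] Eu k => jacMatrix L j i := by
    intro j i
    simp only [jacMatrix, Matrix.of_apply]
    have : ContDiff ℝ r fun L : Eu m →L[ℝ] Eu k => L (EuclideanSpace.single i 1) :=
      contDiff_id.clm_apply contDiff_const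
    fun_prop
  simp only [Matrix.det_apply, Matrix.mul_apply, Matrix.transpose_apply]
  refine ContDiff.sum fun σ _ => ContDiff.const_smul _ (contDiff_prod fun i _ =>
    ContDiff.sum fun j _ => (h _ _).mul (h _ _))

lemma contDiffAt_volFactor {m k : ℕ} {r : WithTop ℕ∞} {L : Eu m →L[ℝ] Eu k}
    (hL : Function.Injective L) : ContDiffAt ℝ r (volFactor : (Eu m →L[ℝ] Eu k) → ℝ) L :=
  contDiff_det_gram.contDiffAt.sqrt (det_gram_pos hL).ne'

lemma continuous_volFactor {m k : ℕ} : Continuous (volFactor : (Eu m →L[ℝ] Eu k) → ℝ) :=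
  (contDiff_det_gram (r := 0)).continuous.sqrt

/-- For a unit vector `η` orthogonal to the range of `L`, the form `i_η Ω` has absolute value
`volFactor L` on the frame given by `L`. -/
lemma abs_stdForm_normal {n : ℕ} (L : Eu n →L[ℝ] Eu (n + 1)) {η : Eu (n + 1)} (h1 : ‖η‖ = 1)
    (h0 : ∀ v, inner ℝ η (L v) = 0) :
    |stdForm n (Matrix.vecCons η fun i => L (EuclideanSpace.single i 1))| = volFactor L := by
  set w : Fin (n + 1) → Eu (n + 1) := Matrix.vecCons η fun i => L (EuclideanSpace.single i 1)
  set A : Matrix (Fin (n + 1)) (Fin (n + 1)) ℝ := Matrix.of fun i j => w i j with hA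
  have hdet : stdForm n w = A.det := by
    rw [stdForm, Module.Basis.det_apply, ← Matrix.det_transpose]
    congr 1
  have hgram : ∀ i j, (A * A.transpose) i j = inner ℝ (w i) (w j) := by
    intro i j
    simp [Matrix.mul_apply, hA, PiLp.inner_apply, mul_comm]
  have hsq : A.det ^ 2 = ((jacMatrix L).transpose * jacMatrix L).det := by
    have e : A.det ^ 2 = (A * A.transpose).det := by
      rw [Matrix.det_mul, Matrix.det_transpose]; ring
    -- The first row of the Gram matrix of `w` is `(1, 0, …, 0)`, so expanding along it leaves the
    -- Gram determinant of `L`.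
    rw [e, Matrix.det_succ_row_zero, Fin.sum_univ_succ]
    have h00 : (A * A.transpose) 0 0 = 1 := by
      rw [hgram]; simp [w, h1]
    have h0s : ∀ i : Fin n, (A * A.transpose) 0 i.succ = 0 := by
      intro i; rw [hgram]; simp [w, h0]
    simp only [h00, h0s]
    simp only [Fin.val_zero, pow_zero, mul_one, one_mul, mul_zero, zero_mul, Finset.sum_const_zero,
      add_zero]
    congr 1
  rw [hdet, volFactor, ← hsq, Real.sqrt_sq_eq_abs]

/-! ### `C²` parametrizations -/

/-- The `C²` version of `IsLocalParam`. -/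
structure IsC2Param {n : ℕ} (M : Set (Eu (n + 1))) (φ : Eu n → Eu (n + 1))
    (U : Set (Eu n)) : Prop where
  isOpen : IsOpen U
  contDiffOn : ContDiffOn ℝ 2 φ U
  immersion : ∀ x ∈ U, Function.Injective (fderiv ℝ φ x)
  injOn : InjOn φ U
  open_image : ∀ W ⊆ U, IsOpen W → ∃ V, IsOpen V ∧ φ '' W = M ∩ V

lemma IsLocalParam.isC2Param {n : ℕ} {M : Set (Eu (n + 1))} {φ : Eu n → Eu (n + 1)}
    {U : Set (Eu n)} (h : IsLocalParam M φ U) : IsC2Param M φ U :=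
  ⟨h.isOpen, h.contDiffOn.of_le (WithTop.coe_le_coe.2 (le_top : (2 : ℕ∞) ≤ ⊤)), h.immersion, h.injOn, h.open_image⟩

lemma IsLocalParam.mono {n : ℕ} {M : Set (Eu (n + 1))} {φ : Eu n → Eu (n + 1)}
    {U W : Set (Eu n)} (h : IsLocalParam M φ U) (hW : IsOpen W) (hWU : W ⊆ U) :
    IsLocalParam M φ W :=
  ⟨hW, h.contDiffOn.mono hWU, fun x hx => h.immersion x (hWU hx), h.injOn.mono hWU,
    fun V hV => h.open_image V (hV.trans hWU)⟩

namespace IsC2Param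

variable {n : ℕ} {M N : Set (Eu (n + 1))} {φ : Eu n → Eu (n + 1)} {U : Set (Eu n)} {x : Eu n}

lemma mapsTo (h : IsC2Param M φ U) : MapsTo φ U M := by
  obtain ⟨V, -, hV⟩ := h.open_image U subset_rfl h.isOpen
  intro x hx
  exact (hV ▸ mem_image_of_mem φ hx : φ x ∈ M ∩ V).1

lemma contDiffAt (h : IsC2Param M φ U) (hx : x ∈ U) : ContDiffAt ℝ 2 φ x :=
  h.contDiffOn.contDiffAt (h.isOpen.mem_nhds hx)

lemma differentiableAt (h : IsC2Param M φ U) (hx : x ∈ U) : DifferentiableAt ℝ φ x :=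
  (h.contDiffAt hx).differentiableAt (by norm_num)

lemma continuousOn (h : IsC2Param M φ U) : ContinuousOn φ U := h.contDiffOn.continuousOn

lemma image_mem_nhdsWithin (h : IsC2Param M φ U) {W : Set (Eu n)} (hW : W ∈ 𝓝 x) (hx : x ∈ U) :
    φ '' W ∈ 𝓝[M] (φ x) := by
  obtain ⟨W', hW', hWo, hxW⟩ := mem_nhds_iff.1 (Filter.inter_mem hW (h.isOpen.mem_nhds hx))
  obtain ⟨V, hVo, hV⟩ := h.open_image W' (hW'.trans inter_subset_right) hWo
  have : M ∩ V ∈ 𝓝[M] (φ x) := inter_mem_nhdsWithin _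
    (hVo.mem_nhds (hV ▸ mem_image_of_mem φ hxW : φ x ∈ M ∩ V).2)
  rw [← hV] at this
  exact mem_of_superset this (image_mono (hW'.trans inter_subset_left))

/-- Near each point, the inverse of a parametrization extends to a `C²` map. -/
lemma exists_local_leftInverse (h : IsC2Param M φ U) (hx : x ∈ U) :
    ∃ G : Eu (n + 1) → Eu n, ContDiffAt ℝ 2 G (φ x) ∧ ∀ᶠ p in 𝓝[M] (φ x), φ (G p) = p ∧ G p ∈ U := by
  -- Composing `φ` with a linear left inverse of its differential gives a map between spaces of
  -- equal dimension with derivative the identity at `x`, to which the inverse function theorem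
  -- applies.
  obtain ⟨l, hl⟩ := LinearMap.exists_leftInverse_of_injective
    (fderiv ℝ φ x : Eu n →ₗ[ℝ] Eu (n + 1)) (LinearMap.ker_eq_bot.2 (h.immersion x hx))
  let L := LinearMap.toContinuousLinearMap l
  have hL : L.comp (fderiv ℝ φ x) = ContinuousLinearMap.id ℝ _ := by
    ext1 v; exact LinearMap.congr_fun hl v
  have hf : ContDiffAt ℝ 2 (fun y => L (φ y)) x := L.contDiff.contDiffAt.comp x (h.contDiffAt hx)
  have hf' : HasFDerivAt (fun y => L (φ y))
      ((ContinuousLinearEquiv.refl ℝ (Eu n) : Eu n ≃L[ℝ] Eu n) : Eu n →L[ℝ] Eu n) x := by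
    have := L.hasFDerivAt.comp x (h.differentiableAt hx).hasFDerivAt
    rw [hL] at this
    exact this
  let e := hf.toOpenPartialHomeomorph _ hf' two_ne_zero
  have hxe : x ∈ e.source := hf.mem_toOpenPartialHomeomorph_source hf' two_ne_zero
  refine ⟨fun p => e.symm (L p), ?_, ?_⟩
  · exact ContDiffAt.comp (φ x) (hf.to_localInverse hf' two_ne_zero) L.contDiff.contDiffAt
  · have hW := h.image_mem_nhdsWithin
      (Filter.inter_mem (h.isOpen.mem_nhds hx) (e.open_source.mem_nhds hxe)) hx
    filter_upwards [hW]
    rintro p ⟨y, ⟨hyU, hye⟩, rfl⟩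
    have : e.symm (L (φ y)) = y := e.left_inv hye
    simp only [this, hyU, and_self]

lemma invFunOn_apply (h : IsC2Param M φ U) (hx : x ∈ U) : Function.invFunOn φ U (φ x) = x :=
  h.injOn.leftInvOn_invFunOn hx

lemma contDiffOn_invFunOn (h : IsC2Param M φ U) :
    ContDiffOn ℝ 2 (Function.invFunOn φ U) (φ '' U) := by
  rintro _ ⟨x, hx, rfl⟩
  obtain ⟨G, hG, hev⟩ := h.exists_local_leftInverse hx
  have hev' : ∀ᶠ p in 𝓝[M] (φ x), Function.invFunOn φ U p = G p := by
    filter_upwards [hev] with p hp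
    conv_lhs => rw [← hp.1]
    exact h.invFunOn_apply hp.2
  have hsub : φ '' U ⊆ M := h.mapsTo.image_subset
  exact (hG.contDiffWithinAt (s := φ '' U)).congr_of_eventuallyEq
    (hev'.filter_mono (nhdsWithin_mono _ hsub))
    (hev'.self_of_nhdsWithin (h.mapsTo hx))

/-- Near `φ x` the map `φ ∘ G` is the identity on `M`, and derivatives within `M` are determined on
the tangent cone; so a tangent vector `v` equals `dφ (dG v)`. Conversely, `dφ` carries the tangent
cone of the open set `U`, which is everything, into that of `M`. -/
lemma tangentConeAt_eq (h : IsC2Param M φ U) (hx : x ∈ U) :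
    tangentConeAt ℝ M (φ x) = range (fderiv ℝ φ x) := by
  apply Subset.antisymm
  · intro v hv
    obtain ⟨G, hG, hev⟩ := h.exists_local_leftInverse hx
    have hGx : G (φ x) = x := by
      have := hev.self_of_nhdsWithin (h.mapsTo hx)
      exact h.injOn this.2 hx this.1
    have h1 : HasFDerivAt (fun p => φ (G p)) ((fderiv ℝ φ x).comp (fderiv ℝ G (φ x))) (φ x) := by
      have hd := (h.differentiableAt hx).hasFDerivAt
      rw [← hGx] at hd
      have := hd.comp (φ x) (hG.differentiableAt (by norm_num)).hasFDerivAt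
      rwa [hGx] at this
    have h2 : HasFDerivWithinAt (fun p => φ (G p)) (ContinuousLinearMap.id ℝ _) M (φ x) :=
      (hasFDerivWithinAt_id (φ x) M).congr_of_eventuallyEq (hev.mono fun p hp => hp.1)
        (hev.self_of_nhdsWithin (h.mapsTo hx)).1
    have := h1.hasFDerivWithinAt.unique_on h2 hv
    exact ⟨fderiv ℝ G (φ x) v, this⟩
  · have h1 := ((h.differentiableAt hx).hasFDerivAt.hasFDerivWithinAt (s := U)).mapsTo_tangent_cone
    rw [tangentConeAt_of_mem_nhds (h.isOpen.mem_nhds hx)] at h1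
    rintro _ ⟨v, rfl⟩
    exact tangentConeAt_mono h.mapsTo.image_subset (h1 (mem_univ v))

/-- Both branches of `outerNormal` return a unit normal, so the Jordan-Brouwer theorem is not
needed. In the second branch one exists because the range of `dφ` has dimension at most `n`. -/
lemma isUnitNormal_outerNormal (h : IsC2Param M φ U) (hx : x ∈ U) :
    IsUnitNormal M (φ x) (outerNormal M (φ x)) := by
  classical
  unfold outerNormal
  split_ifs with hv
  · exact hv.choose_spec.1
  · refine Classical.epsilon_spec (p := IsUnitNormal M (φ x)) ?_
    let R := LinearMap.range (fderiv ℝ φ x : Eu n →ₗ[ℝ] Eu (n + 1))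
    have hR : R ≠ ⊤ := by
      intro hR
      have h1 := LinearMap.finrank_range_le (fderiv ℝ φ x : Eu n →ₗ[ℝ] Eu (n + 1))
      change Module.finrank ℝ R ≤ _ at h1
      rw [hR, finrank_top] at h1
      simp at h1
    have hR' : Rᗮ ≠ ⊥ := fun h => hR (Submodule.orthogonal_eq_bot_iff.1 h)
    obtain ⟨u, huR, hu0⟩ := Submodule.exists_mem_ne_zero_of_ne_bot hR'
    refine ⟨‖u‖⁻¹ • u, norm_smul_inv_norm hu0, fun w hw => ?_⟩
    rw [h.tangentConeAt_eq hx] at hw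
    obtain ⟨v, rfl⟩ := hw
    have h0 : inner ℝ u (fderiv ℝ φ x v) = 0 :=
      (Submodule.mem_orthogonal' _ _).1 huR _ ⟨v, rfl⟩
    rw [inner_smul_left, h0, mul_zero]

lemma abs_volForm (h : IsC2Param M φ U) (hx : x ∈ U) :
    |volForm M (φ x) fun i => fderiv ℝ φ x (EuclideanSpace.single i 1)|
      = volFactor (fderiv ℝ φ x) := by
  have hη := h.isUnitNormal_outerNormal hx
  rw [volForm, AlternatingMap.curryLeft_apply_apply]
  refine abs_stdForm_normal _ hη.1 fun v => hη.2 _ ?_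
  rw [h.tangentConeAt_eq hx]
  exact ⟨v, rfl⟩

lemma volFactor_pos (h : IsC2Param M φ U) (hx : x ∈ U) : 0 < volFactor (fderiv ℝ φ x) :=
  Morphing.volFactor_pos (h.immersion x hx)

lemma hasFDerivAt_comp (h : IsC2Param M φ U) {k : Eu (n + 1) → Eu (n + 1)} (hx : x ∈ U)
    (hk : DifferentiableWithinAt ℝ k M (φ x)) :
    HasFDerivAt (k ∘ φ) ((fderivWithin ℝ k M (φ x)).comp (fderiv ℝ φ x)) x :=
  hk.hasFDerivWithinAt.comp_hasFDerivAt x (h.differentiableAt hx).hasFDerivAt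
    (by filter_upwards [h.isOpen.mem_nhds hx] with y hy using h.mapsTo hy)

/-- As `jacobian` is an epsilon choice, an admissible `c` must be exhibited. Alternating `n`-forms
on an `n`-dimensional space are proportional, so the ratio of the values on the coordinate frame
works. -/
lemma abs_jacobian (h : IsC2Param M φ U) {k : Eu (n + 1) → Eu (n + 1)}
    (h' : IsC2Param N (k ∘ φ) U) (hx : x ∈ U) (hk : DifferentiableWithinAt ℝ k M (φ x)) :
    |jacobian M N k (φ x)| = volFactor (fderiv ℝ (k ∘ φ) x) / volFactor (fderiv ℝ φ x) := by
  have hD := (h.hasFDerivAt_comp hx hk).fderiv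
  let b := (EuclideanSpace.basisFun (Fin n) ℝ).toBasis
  have hb : ∀ i, b i = EuclideanSpace.single i 1 := by intro i; simp [b]
  let α := (volForm M (φ x)).compLinearMap (fderiv ℝ φ x : Eu n →ₗ[ℝ] Eu (n + 1))
  let β := (volForm N (k (φ x))).compLinearMap (fderiv ℝ (k ∘ φ) x : Eu n →ₗ[ℝ] Eu (n + 1))
  have hα : |α b| = volFactor (fderiv ℝ φ x) := by
    rw [← h.abs_volForm hx]
    simp only [α, AlternatingMap.compLinearMap_apply, hb]
    rfl
  have hβ : |β b| = volFactor (fderiv ℝ (k ∘ φ) x) := by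
    rw [← h'.abs_volForm hx]
    simp only [β, AlternatingMap.compLinearMap_apply, Function.comp_def, hb]
    rfl
  have hα0 : α b ≠ 0 := by rw [← abs_pos, hα]; exact h.volFactor_pos hx
  have hex : ∃ c : ℝ, ∀ v : Fin n → Eu (n + 1), (∀ i, v i ∈ tangentConeAt ℝ M (φ x)) →
      volForm N (k (φ x)) (fun i => fderivWithin ℝ k M (φ x) (v i)) = c * volForm M (φ x) v := by
    refine ⟨β b / α b, fun v hv => ?_⟩
    rw [h.tangentConeAt_eq hx] at hv
    choose u hu using hv
    have h1 : volForm M (φ x) v = α u := by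
      simp only [α, AlternatingMap.compLinearMap_apply]
      congr 1; ext1 i; exact (hu i).symm
    have h2 : volForm N (k (φ x)) (fun i => fderivWithin ℝ k M (φ x) (v i)) = β u := by
      simp only [β, AlternatingMap.compLinearMap_apply, hD]
      congr 1; ext1 i; simp [← hu i]
    rw [h1, h2, α.eq_smul_basis_det b, β.eq_smul_basis_det b]
    simp only [AlternatingMap.smul_apply, smul_eq_mul, Module.Basis.det_self, mul_one]
    field_simp
  have hspec := Classical.epsilon_spec hex (fun i => fderiv ℝ φ x (b i))
    (fun i => by rw [h.tangentConeAt_eq hx]; exact ⟨_, rfl⟩)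
  have h3 : β b = jacobian M N k (φ x) * α b := by
    simp only [β, α, AlternatingMap.compLinearMap_apply, hD]
    exact hspec
  rw [← hα, ← hβ, h3, abs_mul, mul_div_cancel_right₀ _ (abs_ne_zero.2 hα0)]

end IsC2Param

lemma IsDiffeo.differentiableWithinAt {n : ℕ} {M N : Set (Eu (n + 1))}
    {k : Eu (n + 1) → Eu (n + 1)} (h : IsDiffeo 2 M N k) {p : Eu (n + 1)} (hp : p ∈ M) :
    DifferentiableWithinAt ℝ k M p :=
  h.1.differentiableOn (by norm_num) p hp

/-- The reason for working with `C²` parametrizations: `k ∘ φ` is in general no smoother.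
Immersivity follows by differentiating `g ∘ (k ∘ φ) = φ`, openness of images from continuity of the
inverse `g`. -/
lemma IsDiffeo.comp_param {n : ℕ} {M N : Set (Eu (n + 1))} {k : Eu (n + 1) → Eu (n + 1)}
    (h : IsDiffeo 2 M N k) {φ : Eu n → Eu (n + 1)} {U : Set (Eu n)} (hφ : IsC2Param M φ U) :
    IsC2Param N (k ∘ φ) U := by
  obtain ⟨hk, hmaps, g, hg, hgmaps, hinv⟩ := h
  refine ⟨hφ.isOpen, hk.comp hφ.contDiffOn hφ.mapsTo, ?_, ?_, ?_⟩
  · intro x hx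
    have hkφ := hφ.hasFDerivAt_comp hx (hk.differentiableOn (by norm_num) _ (hφ.mapsTo hx))
    have hgd := (hg.differentiableOn (by norm_num) (k (φ x))
      (hmaps (hφ.mapsTo hx))).hasFDerivWithinAt
    have h1 : HasFDerivAt (g ∘ (k ∘ φ)) _ x := hgd.comp_hasFDerivAt x hkφ
      (by filter_upwards [hφ.isOpen.mem_nhds hx] with y hy using hmaps (hφ.mapsTo hy))
    have h2 : HasFDerivAt (g ∘ (k ∘ φ)) (fderiv ℝ φ x) x := by
      refine (hφ.differentiableAt hx).hasFDerivAt.congr_of_eventuallyEq ?_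
      filter_upwards [hφ.isOpen.mem_nhds hx] with y hy using hinv.1 (hφ.mapsTo hy)
    have h3 := hφ.immersion x hx
    rw [h2.unique h1] at h3
    rw [hkφ.fderiv]
    exact Function.Injective.of_comp (f := fderivWithin ℝ g N (k (φ x))) h3
  · exact hinv.1.injOn.comp hφ.injOn hφ.mapsTo
  · intro W hWU hW
    obtain ⟨V, hVo, hV⟩ := hφ.open_image W hWU hW
    obtain ⟨V', hV'o, hV'⟩ := continuousOn_iff'.1 hg.continuousOn V hVo
    refine ⟨V', hV'o, ?_⟩
    rw [image_comp, hV, inter_comm N, ← hV']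
    ext q
    constructor
    · rintro ⟨p, ⟨hpM, hpV⟩, rfl⟩
      exact ⟨by simpa [hinv.1 hpM] using hpV, hmaps hpM⟩
    · rintro ⟨hqV, hqN⟩
      exact ⟨g q, ⟨hgmaps hqN, hqV⟩, hinv.2 hqN⟩

/-! ### The volume measure in charts -/

/-- The measure on the image of a parametrization with density `volFactor`. -/
def chartMeasure {n : ℕ} (φ : Eu n → Eu (n + 1)) (U : Set (Eu n)) : Measure (Eu (n + 1)) :=
  ((volume.restrict U).withDensity fun x => ENNReal.ofReal (volFactor (fderiv ℝ φ x))).map φ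

namespace IsC2Param

variable {n : ℕ} {M N : Set (Eu (n + 1))} {φ ψ : Eu n → Eu (n + 1)} {U V : Set (Eu n)} {x : Eu n}

lemma paramMeasure_eq (h : IsC2Param M φ U) : paramMeasure M φ U = chartMeasure φ U := by
  unfold paramMeasure chartMeasure
  congr 1
  refine withDensity_congr_ae ?_
  filter_upwards [ae_restrict_mem h.isOpen.measurableSet] with x hx
  rw [h.abs_volForm hx]

lemma continuousOn_fderiv (h : IsC2Param M φ U) : ContinuousOn (fderiv ℝ φ) U :=
  h.contDiffOn.continuousOn_fderiv_of_isOpen h.isOpen (by norm_num)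

lemma continuousOn_volFactor (h : IsC2Param M φ U) :
    ContinuousOn (fun x => volFactor (fderiv ℝ φ x)) U :=
  continuous_volFactor.comp_continuousOn h.continuousOn_fderiv

lemma contDiffOn_volFactor (h : IsC2Param M φ U) :
    ContDiffOn ℝ 1 (fun x => volFactor (fderiv ℝ φ x)) U := fun x hx =>
  ((contDiffAt_volFactor (h.immersion x hx)).comp x
    (((h.contDiffOn.fderiv_of_isOpen h.isOpen (m := 1) (by norm_num)) x hx).contDiffAt
      (h.isOpen.mem_nhds hx))).contDiffWithinAt

lemma aemeasurable (h : IsC2Param M φ U) {S : Set (Eu n)} (hS : MeasurableSet S) (hSU : S ⊆ U)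
    (ρ : Eu n → ENNReal) : AEMeasurable φ ((volume.restrict S).withDensity ρ) :=
  ((h.continuousOn.mono hSU).aemeasurable hS).mono_ac (withDensity_absolutelyContinuous _ _)

lemma measurableSet_inter_preimage (h : IsC2Param M φ U) {A : Set (Eu (n + 1))}
    (hA : MeasurableSet A) : MeasurableSet (U ∩ φ ⁻¹' A) := by
  have h1 : Measurable (U.domRestrict φ) := h.continuousOn.domRestrict.measurable
  have h2 := h.isOpen.measurableSet.subtype_image (h1 hA)
  rwa [show (Subtype.val '' (U.domRestrict φ ⁻¹' A) : Set (Eu n)) = U ∩ φ ⁻¹' A by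
    ext x; simp [Set.domRestrict, and_comm]] at h2

lemma measurableSet_image (h : IsC2Param M φ U) {S : Set (Eu n)} (hS : MeasurableSet S)
    (hSU : S ⊆ U) : MeasurableSet (φ '' S) :=
  hS.image_of_continuousOn_injOn (h.continuousOn.mono hSU) (h.injOn.mono hSU)

lemma chartMeasure_apply (h : IsC2Param M φ U) {A : Set (Eu (n + 1))} (hA : MeasurableSet A) :
    chartMeasure φ U A = ∫⁻ x in U ∩ φ ⁻¹' A, ENNReal.ofReal (volFactor (fderiv ℝ φ x)) := by
  rw [chartMeasure, Measure.map_apply_of_aemeasurable (h.aemeasurable h.isOpen.measurableSet subset_rfl _) hA, withDensity_apply',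
    Measure.restrict_restrict' h.isOpen.measurableSet, inter_comm]

lemma chartMeasure_inter (h : IsC2Param M φ U) {A : Set (Eu (n + 1))} (hA : MeasurableSet A) :
    chartMeasure φ U (A ∩ φ '' U) = chartMeasure φ U A := by
  rw [h.chartMeasure_apply hA,
    h.chartMeasure_apply (hA.inter (h.measurableSet_image h.isOpen.measurableSet subset_rfl))]
  congr 2
  ext x
  exact ⟨fun hx => ⟨hx.1, hx.2.1⟩, fun hx => ⟨hx.1, hx.2, mem_image_of_mem φ hx.1⟩⟩

/-- The measures defined by two parametrizations agree on the overlap. -/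
lemma chartMeasure_eq_of_subset (h : IsC2Param M φ U) (h' : IsC2Param M ψ V)
    {A : Set (Eu (n + 1))} (hA : MeasurableSet A) (hAU : A ⊆ φ '' U) (hAV : A ⊆ ψ '' V) :
    chartMeasure φ U A = chartMeasure ψ V A := by
  -- The change of charts `ψ⁻¹ ∘ φ`. Since `φ = ψ ∘ θ` near each relevant point, the two densities
  -- differ by `|det dθ|`, exactly the factor in the change of variables formula.
  set θ : Eu n → Eu n := Function.invFunOn ψ V ∘ φ with hθ
  have hθx : ∀ x, φ x ∈ ψ '' V → ψ (θ x) = φ x ∧ θ x ∈ V := fun x hx =>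
    ⟨Function.invFunOn_eq hx, Function.invFunOn_mem hx⟩
  have himage : θ '' (U ∩ φ ⁻¹' A) = V ∩ ψ ⁻¹' A := by
    apply Subset.antisymm
    · rintro _ ⟨x, ⟨-, hxA⟩, rfl⟩
      have := hθx x (hAV hxA)
      exact ⟨this.2, by rw [mem_preimage, this.1]; exact hxA⟩
    · rintro y ⟨hyV, hyA⟩
      obtain ⟨x, hxU, hxy⟩ := hAU hyA
      refine ⟨x, ⟨hxU, by rw [mem_preimage, hxy]; exact hyA⟩, ?_⟩
      rw [hθ, Function.comp_apply, hxy, h'.invFunOn_apply hyV]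
  have hinj : InjOn θ (U ∩ φ ⁻¹' A) := by
    intro x hx y hy hxy
    refine h.injOn hx.1 hy.1 ?_
    rw [← (hθx x (hAV hx.2)).1, ← (hθx y (hAV hy.2)).1, hxy]
  have hnhds : ∀ x ∈ U ∩ φ ⁻¹' A, ∀ᶠ y in 𝓝 x, φ y ∈ ψ '' V := by
    intro x hx
    obtain ⟨y, hyV, hyx⟩ := hAV hx.2
    have h1 := h'.image_mem_nhdsWithin (h'.isOpen.mem_nhds hyV) hyV
    rw [hyx] at h1
    have h2 : Tendsto φ (𝓝 x) (𝓝[M] (φ x)) := tendsto_nhdsWithin_iff.2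
      ⟨(h.contDiffAt hx.1).continuousAt,
        by filter_upwards [h.isOpen.mem_nhds hx.1] with z hz using h.mapsTo hz⟩
    exact h2 h1
  have hdiff : ∀ x ∈ U ∩ φ ⁻¹' A, DifferentiableAt ℝ θ x := by
    intro x hx
    have h1 := (h'.contDiffOn_invFunOn.differentiableOn (by norm_num) _
      (hAV hx.2)).hasFDerivWithinAt
    exact (h1.comp_hasFDerivAt x (h.differentiableAt hx.1).hasFDerivAt
      (hnhds x hx)).differentiableAt
  have hfactor : ∀ x ∈ U ∩ φ ⁻¹' A, volFactor (fderiv ℝ φ x)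
      = volFactor (fderiv ℝ ψ (θ x)) * |(fderiv ℝ θ x).det| := by
    intro x hx
    rw [← volFactor_comp]
    congr 1
    have h1 := (h'.differentiableAt (hθx x (hAV hx.2)).2).hasFDerivAt.comp x
      (hdiff x hx).hasFDerivAt
    exact (h1.congr_of_eventuallyEq ((hnhds x hx).mono fun y hy => (hθx y hy).1.symm)).fderiv
  have hS := h.measurableSet_inter_preimage hA
  rw [h.chartMeasure_apply hA, h'.chartMeasure_apply hA, ← himage,
    lintegral_image_eq_lintegral_abs_det_fderiv_mul volume hS
      (fun x hx => (hdiff x hx).hasFDerivAt.hasFDerivWithinAt) hinj]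
  refine setLIntegral_congr_fun hS fun x hx => ?_
  rw [hfactor x hx, mul_comm, ENNReal.ofReal_mul (abs_nonneg _)]

end IsC2Param

/-- A partition of a hypersurface into finitely many measurable sets, each contained in the image
of a parametrization of finite volume. -/
structure IsDissection {n k : ℕ} (M : Set (Eu (n + 1))) (φ : Fin k → Eu n → Eu (n + 1))
    (U : Fin k → Set (Eu n)) (A : Fin k → Set (Eu (n + 1))) : Prop where
  isLocalParam : ∀ i, IsLocalParam M (φ i) (U i)
  measurableSet : ∀ i, MeasurableSet (A i)
  subset : ∀ i, A i ⊆ φ i '' U i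
  disjoint : Pairwise (Function.onFun Disjoint A)
  iUnion_eq : ⋃ i, A i = M
  chartMeasure_lt_top : ∀ i, chartMeasure (φ i) (U i) univ < ⊤

/-- The density may fail to be integrable over all of `U`, but it is continuous on a closed ball
inside `U`. -/
lemma IsC2Param.exists_chartMeasure_lt_top {n : ℕ} {M : Set (Eu (n + 1))}
    {φ : Eu n → Eu (n + 1)} {U : Set (Eu n)} (h : IsC2Param M φ U) {x : Eu n} (hx : x ∈ U) :
    ∃ r > 0, Metric.ball x r ⊆ U ∧
      ∫⁻ y in Metric.ball x r, ENNReal.ofReal (volFactor (fderiv ℝ φ y)) < ⊤ := by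
  obtain ⟨r, hr, hrU⟩ := Metric.nhds_basis_closedBall.mem_iff.1 (h.isOpen.mem_nhds hx)
  refine ⟨r, hr, Metric.ball_subset_closedBall.trans hrU, ?_⟩
  have h1 : IntegrableOn (fun y => volFactor (fderiv ℝ φ y)) (Metric.closedBall x r) :=
    (h.continuousOn_volFactor.mono hrU).integrableOn_compact (isCompact_closedBall x r)
  have h2 := (h1.mono_set Metric.ball_subset_closedBall).lintegral_lt_top
  exact h2

lemma IsClosedHypersurface.exists_isDissection {n : ℕ} {M : Set (Eu (n + 1))}
    (hM : IsClosedHypersurface M) :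
    ∃ (k : ℕ) (φ : Fin k → Eu n → Eu (n + 1)) (U : Fin k → Set (Eu n))
      (A : Fin k → Set (Eu (n + 1))), IsDissection M φ U A := by
  have h : ∀ p ∈ M, ∃ φ U, IsLocalParam M φ U ∧ p ∈ φ '' U ∧ chartMeasure φ U univ < ⊤ := by
    intro p hp
    obtain ⟨φ, U, hφ, x, hx, rfl⟩ := hM.exists_param p hp
    obtain ⟨r, hr, hrU, hlt⟩ := hφ.isC2Param.exists_chartMeasure_lt_top hx
    have hφ' := hφ.mono Metric.isOpen_ball hrU
    refine ⟨φ, Metric.ball x r, hφ', mem_image_of_mem φ (Metric.mem_ball_self hr), ?_⟩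
    rw [hφ'.isC2Param.chartMeasure_apply MeasurableSet.univ]
    simpa using hlt
  choose! φ U hφ hp hlt using h
  obtain ⟨t, htM, htc⟩ := hM.isCompact.elim_nhdsWithin_subcover (fun p => φ p '' U p) (by
    intro p hpM
    obtain ⟨x, hx, hxp⟩ := hp p hpM
    have := (hφ p hpM).isC2Param.image_mem_nhdsWithin ((hφ p hpM).isOpen.mem_nhds hx) hx
    rwa [hxp] at this)
  let e := t.equivFin.symm
  have heM : ∀ i, (e i : Eu (n + 1)) ∈ M := fun i => htM _ (e i).2
  let B : Fin t.card → Set (Eu (n + 1)) := fun i => φ (e i) '' U (e i)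
  have hB : ∀ i, MeasurableSet (B i) := fun i =>
    (hφ _ (heM i)).isC2Param.measurableSet_image (hφ _ (heM i)).isOpen.measurableSet subset_rfl
  refine ⟨t.card, fun i => φ (e i), fun i => U (e i), disjointed B, fun i => hφ _ (heM i), ?_,
    fun i => disjointed_subset B i, disjoint_disjointed B, ?_, fun i => hlt _ (heM i)⟩
  · intro i
    rw [disjointed_apply, Finset.sup_set_eq_biUnion]
    exact (hB i).diff (Finset.measurableSet_biUnion _ fun j _ => hB j)
  · rw [iUnion_disjointed]
    apply Subset.antisymm
    · exact iUnion_subset fun i => (hφ _ (heM i)).isC2Param.mapsTo.image_subset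
    · intro p hpM
      obtain ⟨q, hq, hpq⟩ := mem_iUnion₂.1 (htc hpM)
      refine mem_iUnion.2 ⟨t.equivFin ⟨q, hq⟩, ?_⟩
      simpa [B, e] using hpq

namespace IsDissection

variable {n k : ℕ} {M : Set (Eu (n + 1))} {φ : Fin k → Eu n → Eu (n + 1)}
    {U : Fin k → Set (Eu n)} {A : Fin k → Set (Eu (n + 1))}

lemma isC2Param (h : IsDissection M φ U A) (i : Fin k) : IsC2Param M (φ i) (U i) :=
  (h.isLocalParam i).isC2Param

lemma measure_eq_sum (h : IsDissection M φ U A) (μ : Measure (Eu (n + 1))) {B : Set (Eu (n + 1))}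
    (hB : MeasurableSet B) (hBM : B ⊆ M) : μ B = ∑ i, μ (B ∩ A i) := by
  conv_lhs => rw [← inter_eq_left.2 hBM, ← h.iUnion_eq, inter_iUnion]
  rw [measure_iUnion, tsum_fintype]
  · exact fun i j hij => (h.disjoint hij).mono inter_subset_right inter_subset_right
  · exact fun i => hB.inter (h.measurableSet i)

lemma chartMeasure_eq_sum (h : IsDissection M φ U A) {ψ : Eu n → Eu (n + 1)} {V : Set (Eu n)}
    (hψ : IsC2Param M ψ V) {B : Set (Eu (n + 1))} (hB : MeasurableSet B) (hBV : B ⊆ ψ '' V) :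
    chartMeasure ψ V B = ∑ i, chartMeasure (φ i) (U i) (B ∩ A i) := by
  rw [h.measure_eq_sum _ hB (hBV.trans hψ.mapsTo.image_subset)]
  refine Finset.sum_congr rfl fun i _ => ?_
  exact hψ.chartMeasure_eq_of_subset (h.isC2Param i) (hB.inter (h.measurableSet i))
    (inter_subset_left.trans hBV) (inter_subset_right.trans (h.subset i))

/-- The supremum is squeezed. The glued measure `μ` dominates every `paramMeasure`, because chart
measures agree on overlaps; conversely each piece of `μ` is a `paramMeasure` on a set `A i`, and
these sets are disjoint. -/
lemma volMeasure_apply (h : IsDissection M φ U A) {B : Set (Eu (n + 1))} (hB : MeasurableSet B) :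
    volMeasure M B = ∑ i, chartMeasure (φ i) (U i) (B ∩ A i) := by
  apply le_antisymm
  · let μ := ∑ i, (chartMeasure (φ i) (U i)).restrict (A i)
    have hμ : ∀ C, MeasurableSet C → μ C = ∑ i, chartMeasure (φ i) (U i) (C ∩ A i) := by
      intro C hC
      simp only [μ, Measure.finsetSum_apply, Measure.restrict_apply hC]
    have hle : volMeasure M ≤ μ := by
      refine iSup_le fun ψ => iSup_le fun V => iSup_le fun hψ => ?_
      have hψ' := hψ.isC2Param
      rw [hψ'.paramMeasure_eq]
      refine Measure.le_iff.2 fun C hC => ?_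
      have hV := hψ'.measurableSet_image hψ'.isOpen.measurableSet subset_rfl
      rw [← hψ'.chartMeasure_inter hC,
        h.chartMeasure_eq_sum hψ' (hC.inter hV) inter_subset_right, hμ C hC]
      exact Finset.sum_le_sum fun i _ =>
        measure_mono (inter_subset_inter_left _ inter_subset_left)
    exact (hle B).trans_eq (hμ B hB)
  · calc ∑ i, chartMeasure (φ i) (U i) (B ∩ A i) ≤ ∑ i, volMeasure M (B ∩ A i) := by
          refine Finset.sum_le_sum fun i _ => ?_
          rw [← (h.isC2Param i).paramMeasure_eq]
          exact (le_iSup_of_le (φ i) (le_iSup_of_le (U i) (le_iSup_of_le (h.isLocalParam i) le_rfl)) :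
            paramMeasure M (φ i) (U i) ≤ volMeasure M) _
      _ = ∑ i, volMeasure M ((B ∩ M) ∩ A i) := by
          refine Finset.sum_congr rfl fun i _ => ?_
          have hi : A i ⊆ M := by rw [← h.iUnion_eq]; exact subset_iUnion A i
          rw [inter_assoc, inter_eq_right.2 hi]
      _ = volMeasure M (B ∩ M) := by
          rw [← h.measure_eq_sum _ (hB.inter _) inter_subset_right]
          exact h.iUnion_eq ▸ MeasurableSet.iUnion h.measurableSet
      _ ≤ volMeasure M B := measure_mono inter_subset_left

end IsDissection

/-- The supremum runs over smooth parametrizations only, but comparison on overlaps needs just `C²`.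
This allows `k ∘ φ` to serve as a chart of the target. -/
lemma IsC2Param.volMeasure_apply {n : ℕ} {M : Set (Eu (n + 1))} (hM : IsClosedHypersurface M)
    {φ : Eu n → Eu (n + 1)} {U : Set (Eu n)} (h : IsC2Param M φ U) {B : Set (Eu (n + 1))}
    (hB : MeasurableSet B) (hBU : B ⊆ φ '' U) : volMeasure M B = chartMeasure φ U B := by
  obtain ⟨k, ψ, V, A, hA⟩ := hM.exists_isDissection
  rw [hA.volMeasure_apply hB, hA.chartMeasure_eq_sum h hB hBU]

lemma IsC2Param.volMeasure_restrict {n : ℕ} {M : Set (Eu (n + 1))} (hM : IsClosedHypersurface M)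
    {φ : Eu n → Eu (n + 1)} {U S : Set (Eu n)} (h : IsC2Param M φ U) (hS : MeasurableSet S)
    (hSU : S ⊆ U) : (volMeasure M).restrict (φ '' S) =
      ((volume.restrict S).withDensity fun x => ENNReal.ofReal (volFactor (fderiv ℝ φ x))).map φ := by
  have hSm := h.measurableSet_image hS hSU
  refine Measure.ext fun B hB => ?_
  rw [Measure.restrict_apply hB, h.volMeasure_apply hM (hB.inter hSm)
    (inter_subset_right.trans (image_mono hSU)), h.chartMeasure_apply (hB.inter hSm),
    Measure.map_apply_of_aemeasurable (h.aemeasurable hS hSU _) hB, withDensity_apply',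
    Measure.restrict_restrict' hS]
  congr 2
  ext x
  constructor
  · rintro ⟨hxU, hxB, y, hy, hyx⟩
    rw [h.injOn (hSU hy) hxU hyx] at hy
    exact ⟨hxB, hy⟩
  · exact fun hx => ⟨hSU hx.2, hx.1, mem_image_of_mem φ hx.2⟩

/-! ### Finiteness, support and positivity of the volume measure. -/

namespace IsClosedHypersurface

variable {n : ℕ} {M N : Set (Eu (n + 1))}

lemma measurableSet (hM : IsClosedHypersurface M) : MeasurableSet M := hM.isCompact.measurableSet

lemma isFiniteMeasure (hM : IsClosedHypersurface M) : IsFiniteMeasure (volMeasure M) := by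
  obtain ⟨k, ψ, V, A, hA⟩ := hM.exists_isDissection
  refine ⟨?_⟩
  rw [hA.volMeasure_apply MeasurableSet.univ]
  exact ENNReal.sum_lt_top.2 fun i _ =>
    (measure_mono (subset_univ _)).trans_lt (hA.chartMeasure_lt_top i)

lemma volMeasure_compl (hM : IsClosedHypersurface M) : volMeasure M Mᶜ = 0 := by
  obtain ⟨k, ψ, V, A, hA⟩ := hM.exists_isDissection
  rw [hA.volMeasure_apply hM.measurableSet.compl]
  refine Finset.sum_eq_zero fun i _ => ?_
  have : Mᶜ ∩ A i = ∅ := by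
    rw [← disjoint_iff_inter_eq_empty]
    exact disjoint_compl_left_iff_subset.2 (hA.iUnion_eq ▸ subset_iUnion A i)
  rw [this, measure_empty]

lemma restrict_volMeasure (hM : IsClosedHypersurface M) :
    (volMeasure M).restrict M = volMeasure M := by
  rw [Measure.restrict_eq_self_of_ae_mem]
  exact mem_ae_iff.2 hM.volMeasure_compl

lemma Vol_pos (hM : IsClosedHypersurface M) : 0 < Vol M := by
  obtain ⟨p, hp⟩ := hM.isConnected.nonempty
  obtain ⟨φ, U, hφ, x, hx, -⟩ := hM.exists_param p hp
  have h := hφ.isC2Param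
  have := hM.isFiniteMeasure
  refine ENNReal.toReal_pos ?_ (measure_ne_top _ _)
  have hU := h.measurableSet_image h.isOpen.measurableSet subset_rfl
  have h1 : 0 < volMeasure M (φ '' U) := by
    rw [h.volMeasure_apply hM hU subset_rfl, h.chartMeasure_apply hU,
      inter_eq_left.2 (subset_preimage_image φ U), pos_iff_ne_zero]
    intro h0
    rw [lintegral_eq_zero_iff'
      (h.continuousOn_volFactor.aemeasurable h.isOpen.measurableSet).ennreal_ofReal] at h0
    have h2 : ∀ᵐ y ∂(volume.restrict U), False := by
      filter_upwards [h0, ae_restrict_mem h.isOpen.measurableSet] with y hy hyU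
      exact (ENNReal.ofReal_pos.2 (h.volFactor_pos hyU)).ne' hy
    have h3 : volume U = 0 := by simpa [ae_iff] using h2
    exact (h.isOpen.measure_pos volume ⟨x, hx⟩).ne' h3
  exact (h1.trans_le (measure_mono (subset_univ _))).ne'

end IsClosedHypersurface

/-! ### Change of variables and the Jacobian -/

section Jacobian

variable {n : ℕ} {M N : Set (Eu (n + 1))} {φ : Eu n → Eu (n + 1)} {U S : Set (Eu n)}
  {k : Eu (n + 1) → Eu (n + 1)}

lemma IsClosedHypersurface.exists_isC2Param (hM : IsClosedHypersurface M) {p : Eu (n + 1)}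
    (hp : p ∈ M) : ∃ φ U, IsC2Param M φ U ∧ ∃ x ∈ U, φ x = p := by
  obtain ⟨φ, U, hφ, x, hx, rfl⟩ := hM.exists_param p hp
  exact ⟨φ, U, hφ.isC2Param, x, hx, rfl⟩

lemma IsDiffeo.abs_jacobian_apply (hk : IsDiffeo 2 M N k) (hφ : IsC2Param M φ U) {x : Eu n}
    (hx : x ∈ U) : |jacobian M N k (φ x)| =
      volFactor (fderiv ℝ (k ∘ φ) x) / volFactor (fderiv ℝ φ x) :=
  hφ.abs_jacobian (hk.comp_param hφ) hx (hk.differentiableWithinAt (hφ.mapsTo hx))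

lemma IsDiffeo.abs_jacobian_pos (hM : IsClosedHypersurface M) (hk : IsDiffeo 2 M N k)
    {p : Eu (n + 1)} (hp : p ∈ M) : 0 < |jacobian M N k p| := by
  obtain ⟨φ, U, hφ, x, hx, rfl⟩ := hM.exists_isC2Param hp
  rw [hk.abs_jacobian_apply hφ hx]
  exact div_pos ((hk.comp_param hφ).volFactor_pos hx) (hφ.volFactor_pos hx)

lemma IsDiffeo.continuousOn_abs_jacobian (hM : IsClosedHypersurface M) (hk : IsDiffeo 2 M N k) :
    ContinuousOn (fun p => |jacobian M N k p|) M := by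
  intro p hp
  obtain ⟨φ, U, hφ, x, hx, rfl⟩ := hM.exists_isC2Param hp
  have hU : φ '' U ∈ 𝓝[M] (φ x) := hφ.image_mem_nhdsWithin (hφ.isOpen.mem_nhds hx) hx
  have h1 : ContinuousOn (fun y => volFactor (fderiv ℝ (k ∘ φ) y) / volFactor (fderiv ℝ φ y)) U :=
    (hk.comp_param hφ).continuousOn_volFactor.div hφ.continuousOn_volFactor
      fun y hy => (hφ.volFactor_pos hy).ne'
  have h2 := h1.comp hφ.contDiffOn_invFunOn.continuousOn
    (fun q hq => Function.invFunOn_mem hq)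
  have h3 : ContinuousOn (fun p => |jacobian M N k p|) (φ '' U) := by
    refine h2.congr ?_
    rintro _ ⟨y, hy, rfl⟩
    simp only [Function.comp_apply, hφ.invFunOn_apply hy]
    exact hk.abs_jacobian_apply hφ hy
  exact (h3 _ (mem_image_of_mem φ hx)).mono_of_mem_nhdsWithin hU

lemma IsClosedHypersurface.integrable_of_continuousOn (hM : IsClosedHypersurface M)
    {F : Eu (n + 1) → ℝ} (hF : ContinuousOn F M) : Integrable F (volMeasure M) := by
  have := hM.isFiniteMeasure
  have h := hF.integrableOn_compact (μ := volMeasure M) hM.isCompact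
  rwa [IntegrableOn, hM.restrict_volMeasure] at h

lemma IsC2Param.aemeasurable_volFactor (hφ : IsC2Param M φ U) (hS : MeasurableSet S)
    (hSU : S ⊆ U) : AEMeasurable (fun x => ENNReal.ofReal (volFactor (fderiv ℝ φ x)))
      (volume.restrict S) :=
  ((hφ.continuousOn_volFactor.mono hSU).aemeasurable hS).ennreal_ofReal

lemma IsC2Param.setIntegral_image (hM : IsClosedHypersurface M) (hφ : IsC2Param M φ U)
    (hS : MeasurableSet S) (hSU : S ⊆ U) {F : Eu (n + 1) → ℝ} (hF : ContinuousOn F M) :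
    ∫ p in φ '' S, F p ∂(volMeasure M) = ∫ x in S, F (φ x) * volFactor (fderiv ℝ φ x) := by
  have hm := (hM.integrable_of_continuousOn hF).aestronglyMeasurable.restrict (s := φ '' S)
  rw [hφ.volMeasure_restrict hM hS hSU] at hm ⊢
  rw [integral_map (hφ.aemeasurable hS hSU _) hm,
    integral_withDensity_eq_integral_toReal_smul₀ (hφ.aemeasurable_volFactor hS hSU)
      (ae_of_all _ fun _ => ENNReal.ofReal_lt_top)]
  refine setIntegral_congr_fun hS fun x _ => ?_
  rw [ENNReal.toReal_ofReal (volFactor_nonneg _), smul_eq_mul, mul_comm]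

lemma IsC2Param.setLIntegral_image (hM : IsClosedHypersurface M) (hφ : IsC2Param M φ U)
    (hS : MeasurableSet S) (hSU : S ⊆ U) {F : Eu (n + 1) → ℝ} (hF : ContinuousOn F M) :
    ∫⁻ p in φ '' S, ENNReal.ofReal (F p) ∂(volMeasure M)
      = ∫⁻ x in S, ENNReal.ofReal (volFactor (fderiv ℝ φ x)) * ENNReal.ofReal (F (φ x)) := by
  have hm := (hM.integrable_of_continuousOn hF).aestronglyMeasurable.aemeasurable.ennreal_ofReal.restrict
    (s := φ '' S)
  have hae := hφ.aemeasurable hS hSU fun x => ENNReal.ofReal (volFactor (fderiv ℝ φ x))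
  rw [hφ.volMeasure_restrict hM hS hSU] at hm ⊢
  rw [lintegral_map' hm hae]
  exact lintegral_withDensity_eq_lintegral_mul_non_measurable₀ _
    (hφ.aemeasurable_volFactor hS hSU) (ae_of_all _ fun _ => ENNReal.ofReal_lt_top) _

/-- Change of variables: the volume of the target is the integral of the Jacobian. -/
lemma IsDiffeo.Vol_eq_integral (hM : IsClosedHypersurface M) (hN : IsClosedHypersurface N)
    (hk : IsDiffeo 2 M N k) : Vol N = ∫ p, |jacobian M N k p| ∂(volMeasure M) := by
  obtain ⟨m, φ, U, A, hA⟩ := hM.exists_isDissection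
  have hcont := hk.continuousOn_abs_jacobian hM
  obtain ⟨g, hg, hgmaps, hinv⟩ := hk.2.2
  have hinj : InjOn k M := hinv.1.injOn
  have hsurj : k '' M = N := Subset.antisymm hk.2.1.image_subset
    fun q hq => ⟨g q, hgmaps hq, hinv.2 hq⟩
  have hAM : ∀ i, A i ⊆ M := fun i => by rw [← hA.iUnion_eq]; exact subset_iUnion A i
  have hkA : ∀ i, MeasurableSet (k '' A i) := fun i =>
    (hA.measurableSet i).image_of_continuousOn_injOn (hk.1.continuousOn.mono (hAM i))
      (hinj.mono (hAM i))
  have hdisj : Pairwise (Function.onFun Disjoint fun i => k '' A i) := fun i j hij =>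
    disjoint_image_image fun x hx y hy hxy =>
      (hA.disjoint hij).ne_of_mem hx hy (hinj (hAM i hx) (hAM j hy) hxy)
  have hvol : volMeasure N univ = ∑ i, volMeasure N (k '' A i) := by
    have : volMeasure N univ = volMeasure N N := by
      rw [← hN.restrict_volMeasure, Measure.restrict_apply_univ, hN.restrict_volMeasure]
    rw [this, ← tsum_fintype (L := .unconditional _), ← measure_iUnion hdisj hkA, ← image_iUnion, hA.iUnion_eq, hsurj]
  have hint : ∫⁻ p, ENNReal.ofReal |jacobian M N k p| ∂(volMeasure M)
      = ∑ i, ∫⁻ p in A i, ENNReal.ofReal |jacobian M N k p| ∂(volMeasure M) := by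
    rw [← tsum_fintype (L := .unconditional _), ← lintegral_iUnion hA.measurableSet hA.disjoint, hA.iUnion_eq,
      hM.restrict_volMeasure]
  have hpiece : ∀ i, volMeasure N (k '' A i)
      = ∫⁻ p in A i, ENNReal.ofReal |jacobian M N k p| ∂(volMeasure M) := by
    intro i
    have hφ := hA.isC2Param i
    have hkφ := hk.comp_param hφ
    have hS := hφ.measurableSet_inter_preimage (hA.measurableSet i)
    have himage : φ i '' (U i ∩ φ i ⁻¹' A i) = A i := by
      rw [image_inter_preimage, inter_eq_right.2 (hA.subset i)]
    have hpre : U i ∩ (k ∘ φ i) ⁻¹' (k '' A i) = U i ∩ φ i ⁻¹' A i := by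
      ext x
      refine and_congr_right fun hx => ⟨?_, fun h => mem_image_of_mem k h⟩
      rintro ⟨p, hp, hpx⟩
      rwa [mem_preimage, ← hinj (hAM i hp) (hφ.mapsTo hx) hpx]
    have hsub : k '' A i ⊆ (k ∘ φ i) '' U i := by
      rw [image_comp]; exact image_mono (hA.subset i)
    rw [hkφ.volMeasure_apply hN (hkA i) hsub, hkφ.chartMeasure_apply (hkA i), hpre]
    conv_rhs => rw [← himage]
    rw [hφ.setLIntegral_image hM hS inter_subset_left hcont]
    refine setLIntegral_congr_fun hS fun x hx => ?_
    rw [← ENNReal.ofReal_mul (volFactor_nonneg _), hk.abs_jacobian_apply hφ hx.1,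
      mul_div_cancel₀ _ (hφ.volFactor_pos hx.1).ne']
  rw [integral_eq_lintegral_of_nonneg_ae (ae_of_all _ fun _ => abs_nonneg _)
    (hM.integrable_of_continuousOn hcont).aestronglyMeasurable, hint, Vol, Measure.real, hvol]
  simp only [hpiece]

lemma IsClosedHypersurface.integral_congr (hM : IsClosedHypersurface M) {F G : Eu (n + 1) → ℝ}
    (h : EqOn F G M) : ∫ p, F p ∂(volMeasure M) = ∫ p, G p ∂(volMeasure M) := by
  rw [← hM.restrict_volMeasure]
  exact setIntegral_congr_fun hM.measurableSet h

/-- Change of variables reads `Vol N = c * Vol M`, and the distortion is `(c - 1) ^ 2 * Vol M`. -/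
lemma IsDiffeo.mapDistortion_of_const (hM : IsClosedHypersurface M) (hN : IsClosedHypersurface N)
    (hk : IsDiffeo 2 M N k) {c : ℝ} (hc : ∀ p ∈ M, |jacobian M N k p| = c) :
    c = Vol N / Vol M ∧ mapDistortion M N k = (Vol N - Vol M) ^ 2 / Vol M := by
  have hpos := hM.Vol_pos
  have h1 : Vol N = c * Vol M := by
    rw [hk.Vol_eq_integral hM hN, hM.integral_congr (G := fun _ => c) hc, integral_const,
      smul_eq_mul, mul_comm, Vol]
  refine ⟨by rw [h1]; field_simp, ?_⟩
  rw [mapDistortion, hM.integral_congr (G := fun _ => (c - 1) ^ 2)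
    (fun p hp => by simp only [hc p hp]), integral_const, smul_eq_mul, h1]
  change Vol M * _ = _
  field_simp

end Jacobian

/-! ### Variations supported in a chart -/

section Variation

variable {n : ℕ} {M N : Set (Eu (n + 1))} {φ : Eu n → Eu (n + 1)} {U K : Set (Eu n)}
  {k : Eu (n + 1) → Eu (n + 1)}

open Classical in
/-- Transport of a family `F` of maps of the parameter domain `U` to maps of the hypersurface,
extended by the identity outside the image of the parametrization `φ`. -/
def chartExtend (φ : Eu n → Eu (n + 1)) (U : Set (Eu n)) (F : ℝ → Eu n → Eu n) (ε : ℝ)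
    (p : Eu (n + 1)) : Eu (n + 1) :=
  if p ∈ φ '' U then φ (F ε (Function.invFunOn φ U p)) else p

lemma IsC2Param.chartExtend_apply (hφ : IsC2Param M φ U) (F : ℝ → Eu n → Eu n) (ε : ℝ) {x : Eu n}
    (hx : x ∈ U) : chartExtend φ U F ε (φ x) = φ (F ε x) := by
  rw [chartExtend, if_pos (mem_image_of_mem φ hx), hφ.invFunOn_apply hx]

lemma chartExtend_of_notMem_image (F : ℝ → Eu n → Eu n) (ε : ℝ) {p : Eu (n + 1)}
    (hp : p ∉ φ '' U) : chartExtend φ U F ε p = p := by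
  rw [chartExtend, if_neg hp]

lemma IsC2Param.chartExtend_of_notMem (hφ : IsC2Param M φ U) {F : ℝ → Eu n → Eu n} {ε : ℝ}
    (hF : ∀ x ∈ U \ K, F ε x = x) {p : Eu (n + 1)} (hp : p ∉ φ '' K) :
    chartExtend φ U F ε p = p := by
  by_cases hpU : p ∈ φ '' U
  · obtain ⟨x, hx, rfl⟩ := hpU
    rw [hφ.chartExtend_apply F ε hx, hF x ⟨hx, fun hxK => hp (mem_image_of_mem φ hxK)⟩]
  · rw [chartExtend, if_neg hpU]

lemma IsC2Param.isClosed_image (hφ : IsC2Param M φ U) (hK : IsCompact K) (hKU : K ⊆ U) :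
    IsClosed (φ '' K) := (hK.image_of_continuousOn (hφ.continuousOn.mono hKU)).isClosed

lemma IsC2Param.mapsTo_chartExtend (hφ : IsC2Param M φ U) {F : ℝ → Eu n → Eu n} {ε : ℝ}
    (hF : MapsTo (F ε) U U) : MapsTo (chartExtend φ U F ε) M M := by
  intro p hp
  by_cases hpU : p ∈ φ '' U
  · obtain ⟨x, hx, rfl⟩ := hpU
    rw [hφ.chartExtend_apply F ε hx]
    exact hφ.mapsTo (hF hx)
  · rwa [chartExtend, if_neg hpU]

/-- The relatively open sets `φ '' U` and `M \ φ '' K` cover `M`. On the first the map is a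
composition of `C²` maps, on the second it is the identity. -/
lemma IsC2Param.contDiffOn_chartExtend (hφ : IsC2Param M φ U) (hK : IsCompact K) (hKU : K ⊆ U)
    {F : ℝ → Eu n → Eu n} {S : Set ℝ}
    (hF : ContDiffOn ℝ 2 (fun q : ℝ × Eu n => F q.1 q.2) (S ×ˢ U))
    (hmaps : ∀ ε ∈ S, MapsTo (F ε) U U) (hFK : ∀ ε ∈ S, ∀ x ∈ U \ K, F ε x = x) :
    ContDiffOn ℝ 2 (fun q : ℝ × Eu (n + 1) => chartExtend φ U F q.1 q.2) (S ×ˢ M) := by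
  rintro ⟨ε, p⟩ ⟨hε, hp⟩
  by_cases hpU : p ∈ φ '' U
  · have h1 : ContDiffOn ℝ 2 (fun q : ℝ × Eu (n + 1) => (q.1, Function.invFunOn φ U q.2))
        (S ×ˢ (φ '' U)) :=
      contDiffOn_fst.prodMk (hφ.contDiffOn_invFunOn.comp contDiffOn_snd fun q hq => hq.2)
    have h2 : ContDiffOn ℝ 2 (fun q : ℝ × Eu (n + 1) => F q.1 (Function.invFunOn φ U q.2))
        (S ×ˢ (φ '' U)) :=
      hF.comp h1 fun q hq => ⟨hq.1, Function.invFunOn_mem hq.2⟩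
    have h3 : ContDiffOn ℝ 2 (fun q : ℝ × Eu (n + 1) => chartExtend φ U F q.1 q.2)
        (S ×ˢ (φ '' U)) := by
      refine (hφ.contDiffOn.comp h2 fun q hq =>
        hmaps _ hq.1 (Function.invFunOn_mem hq.2)).congr fun q hq => ?_
      simp only [chartExtend, if_pos hq.2, Function.comp_apply]
    refine (h3 (ε, p) ⟨hε, hpU⟩).mono_of_mem_nhdsWithin ?_
    obtain ⟨x, hx, rfl⟩ := hpU
    rw [nhdsWithin_prod_eq]
    exact prod_mem_prod self_mem_nhdsWithin
      (hφ.image_mem_nhdsWithin (hφ.isOpen.mem_nhds hx) hx)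
  · have hpK : p ∉ φ '' K := fun h => hpU (image_mono hKU h)
    refine contDiffWithinAt_snd.congr_of_eventuallyEq ?_
      (hφ.chartExtend_of_notMem (hFK ε hε) hpK)
    have hc : (φ '' K)ᶜ ∈ 𝓝 p := (hφ.isClosed_image hK hKU).isOpen_compl.mem_nhds hpK
    have h1 : ∀ᶠ q : ℝ × Eu (n + 1) in 𝓝[S ×ˢ M] (ε, p), q.2 ∉ φ '' K :=
      ((continuous_snd.tendsto (ε, p)).eventually hc).filter_mono nhdsWithin_le_nhds
    filter_upwards [h1, self_mem_nhdsWithin] with q hq hqS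
    exact hφ.chartExtend_of_notMem (hFK _ hqS.1) hq

/-- A small perturbation of the identity is a `C²` diffeomorphism. -/
lemma exists_homeomorph_add_smul {X : Eu n → Eu n} (hX : ContDiff ℝ 2 X)
    (hL : LipschitzWith (1 / 2) X) {ε : ℝ} (hε : ε ∈ Ioo (-1 : ℝ) 1) :
    ∃ Ψ : Eu n ≃ₜ Eu n, (∀ x, Ψ x = x + ε • X x) ∧ ContDiff ℝ 2 Ψ.symm := by
  have hε1 : |ε| ≤ 1 := abs_le.2 ⟨hε.1.le, hε.2.le⟩
  have happ : ApproximatesLinearOn (fun x => x + ε • X x)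
      ((ContinuousLinearEquiv.refl ℝ (Eu n) : Eu n ≃L[ℝ] Eu n) : Eu n →L[ℝ] Eu n) univ
      (1 / 2) := by
    intro x _ y _
    have h1 : x + ε • X x - (y + ε • X y) - (x - y) = ε • (X x - X y) := by
      rw [smul_sub]; abel
    have h2 := hL.norm_sub_le x y
    change ‖x + ε • X x - (y + ε • X y) - (x - y)‖ ≤ _
    rw [h1, norm_smul, Real.norm_eq_abs]
    exact (mul_le_of_le_one_left (norm_nonneg _) hε1).trans h2
  -- For `n = 0` the identity has norm `0`, so that case is separate.
  have hc : Subsingleton (Eu n) ∨ (1 / 2 : NNReal) <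
      ‖((ContinuousLinearEquiv.refl ℝ (Eu n)).symm : Eu n →L[ℝ] Eu n)‖₊⁻¹ := by
    rcases subsingleton_or_nontrivial (Eu n) with h | h
    · exact Or.inl h
    · right
      have : ‖((ContinuousLinearEquiv.refl ℝ (Eu n)).symm : Eu n →L[ℝ] Eu n)‖₊ = 1 := by
        ext; exact ContinuousLinearMap.norm_id
      rw [this, inv_one, ← NNReal.coe_lt_coe]
      norm_num
  let Ψ := happ.toHomeomorph _ hc
  -- A kernel vector satisfies `v = -ε dX(v)`, hence `‖v‖ ≤ ‖v‖ / 2`.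
  have hinj : ∀ a, Function.Injective
      (ContinuousLinearMap.id ℝ (Eu n) + ε • fderiv ℝ X a : Eu n →L[ℝ] Eu n) := by
    intro a
    refine (injective_iff_map_eq_zero _).2 fun v hv => ?_
    have h1 : v = -(ε • fderiv ℝ X a v) := by
      rw [eq_neg_iff_add_eq_zero]; exact hv
    have h2 : ‖fderiv ℝ X a v‖ ≤ 1 / 2 * ‖v‖ := by
      have := (fderiv ℝ X a).le_of_opNorm_le (norm_fderiv_le_of_lipschitz ℝ hL (x₀ := a)) v
      simpa using this
    have h3 : ‖v‖ ≤ 1 / 2 * ‖v‖ := by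
      calc ‖v‖ = |ε| * ‖fderiv ℝ X a v‖ := by
            conv_lhs => rw [h1]
            rw [norm_neg, norm_smul, Real.norm_eq_abs]
        _ ≤ _ := (mul_le_of_le_one_left (norm_nonneg _) hε1).trans h2
    exact norm_le_zero_iff.1 (by linarith)
  refine ⟨Ψ, fun x => rfl, ?_⟩
  refine Ψ.contDiff_symm (f₀' := fun a => (LinearEquiv.ofInjectiveEndo
    ((ContinuousLinearMap.id ℝ (Eu n) + ε • fderiv ℝ X a : Eu n →L[ℝ] Eu n) : Eu n →ₗ[ℝ] Eu n)
      (hinj a)).toContinuousLinearEquiv) (fun a => ?_) ?_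
  · have h1 : HasFDerivAt (fun x => x + ε • X x)
        (ContinuousLinearMap.id ℝ (Eu n) + ε • fderiv ℝ X a) a :=
      (hasFDerivAt_id a).add (((hX.differentiable (by norm_num)) a).hasFDerivAt.const_smul ε)
    exact h1.congr_fderiv (by ext1 v; rfl)
  · exact contDiff_id.add (hX.const_smul ε)

/-- The variation `k ∘ φ ∘ (id + ε X) ∘ φ⁻¹` of a diffeomorphism `k`. -/
lemma IsDiffeo.isVariation_chartExtend (hk : IsDiffeo 2 M N k) (hφ : IsC2Param M φ U)
    (hK : IsCompact K) (hKU : K ⊆ U) {X : Eu n → Eu n} (hX : ContDiff ℝ 2 X)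
    (hL : LipschitzWith (1 / 2) X) (hXK : ∀ x ∉ K, X x = 0) :
    (∀ ε ∈ Ioo (-1 : ℝ) 1, MapsTo (fun x => x + ε • X x) U U) ∧
    IsVariation M N k (fun ε p => k (chartExtend φ U (fun ε x => x + ε • X x) ε p)) := by
  set F : ℝ → Eu n → Eu n := fun ε x => x + ε • X x
  have hFK : ∀ ε, ∀ x ∉ K, F ε x = x := fun ε x hx => by simp [F, hXK x hx]
  have hmaps : ∀ ε ∈ Ioo (-1 : ℝ) 1, MapsTo (F ε) U U := by
    intro ε hε x hx
    obtain ⟨Ψ, hΨ, -⟩ := exists_homeomorph_add_smul hX hL hε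
    -- A point `F ε x` outside `U` lies off `K`, so `F ε` fixes it; injectivity then forces `F ε x =
    -- x`, which is in `U`.
    by_contra hFx
    have h1 := hFK ε (F ε x) fun h => hFx (hKU h)
    have h2 : F ε x = x := Ψ.injective (by rw [hΨ, hΨ]; exact h1)
    exact hFx (show F ε x ∈ U by rw [h2]; exact hx)
  have hFc : ContDiffOn ℝ 2 (fun q : ℝ × Eu n => F q.1 q.2) (Ioo (-1 : ℝ) 1 ×ˢ U) := by
    have : ContDiff ℝ 2 (fun q : ℝ × Eu n => q.2 + q.1 • X q.2) :=
      contDiff_snd.add (contDiff_fst.smul (hX.comp contDiff_snd))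
    exact this.contDiffOn
  have hext := hφ.contDiffOn_chartExtend hK hKU hFc hmaps fun ε _ x hx => hFK ε x hx.2
  obtain ⟨hk1, hk2, g, hg1, hg2, hinv⟩ := hk
  refine ⟨hmaps, ⟨fun ε hε => ?_, fun p hp => ?_, ?_⟩⟩
  · obtain ⟨Ψ, hΨ, hΨs⟩ := exists_homeomorph_add_smul hX hL hε
    have hsK : ∀ x ∉ K, Ψ.symm x = x := fun x hx => by
      rw [Ψ.symm_apply_eq, hΨ]; exact (hFK ε x hx).symm
    have hsmaps : MapsTo Ψ.symm U U := by
      intro x hx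
      by_contra h
      have h1 := hFK ε _ fun h' => h (hKU h')
      have h2 : Ψ (Ψ.symm x) = Ψ.symm x := by rw [hΨ]; exact h1
      rw [Ψ.apply_symm_apply] at h2
      exact h (h2 ▸ hx)
    -- The inverse is viewed as a family constant in the parameter, so the extension lemmas apply;
    -- the value `0` used below is a dummy.
    let G : ℝ → Eu n → Eu n := fun _ x => Ψ.symm x
    have hGmaps : MapsTo (chartExtend φ U G 0) M M := hφ.mapsTo_chartExtend hsmaps
    have hG : ContDiffOn ℝ 2 (chartExtend φ U G 0) M := by
      have h1 := hφ.contDiffOn_chartExtend (F := G) (S := univ) hK hKU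
        (hΨs.comp contDiff_snd).contDiffOn (fun _ _ => hsmaps) (fun _ _ x hx => hsK x hx.2)
      exact h1.comp (contDiff_const (c := (0 : ℝ)).prodMk contDiff_id).contDiffOn
        fun p hp => ⟨mem_univ _, hp⟩
    have hFmaps : MapsTo (chartExtend φ U F ε) M M := hφ.mapsTo_chartExtend (hmaps ε hε)
    have hF : ContDiffOn ℝ 2 (chartExtend φ U F ε) M :=
      hext.comp (contDiff_const (c := ε).prodMk contDiff_id).contDiffOn fun p hp => ⟨hε, hp⟩
    have hGF : ∀ p, chartExtend φ U G 0 (chartExtend φ U F ε p) = p := by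
      intro p
      by_cases hp : p ∈ φ '' U
      · obtain ⟨x, hx, rfl⟩ := hp
        rw [hφ.chartExtend_apply F ε hx, hφ.chartExtend_apply G 0 (hmaps ε hε hx)]
        change φ (Ψ.symm (x + ε • X x)) = φ x
        rw [← hΨ, Ψ.symm_apply_apply]
      · rw [chartExtend_of_notMem_image F ε hp, chartExtend_of_notMem_image G 0 hp]
    have hFG : ∀ p, chartExtend φ U F ε (chartExtend φ U G 0 p) = p := by
      intro p
      by_cases hp : p ∈ φ '' U
      · obtain ⟨x, hx, rfl⟩ := hp
        rw [hφ.chartExtend_apply G 0 hx, hφ.chartExtend_apply F ε (hsmaps hx)]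
        change φ (Ψ.symm x + ε • X (Ψ.symm x)) = φ x
        rw [← hΨ, Ψ.apply_symm_apply]
      · rw [chartExtend_of_notMem_image G 0 hp, chartExtend_of_notMem_image F ε hp]
    refine ⟨hk1.comp hF hFmaps, hk2.comp hFmaps, chartExtend φ U G 0 ∘ g, hG.comp hg1 hg2,
      hGmaps.comp hg2, fun p hp => ?_, fun q hq => ?_⟩
    · simp only [Function.comp_apply]
      rw [hinv.1 (hFmaps hp), hGF]
    · simp only [Function.comp_apply]
      rw [hFG, hinv.2 hq]
  · have : chartExtend φ U F 0 p = p :=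
      hφ.chartExtend_of_notMem (K := ∅) (fun x _ => by simp [F]) (by simp)
    exact congrArg k this
  · exact hk1.comp hext fun q hq => hφ.mapsTo_chartExtend (hmaps _ hq.1) hq.2

end Variation

/-! ### Distortion minimal maps have constant Jacobian -/

lemma hasDerivAt_slice_of_contDiffOn {E : Type*} [NormedAddCommGroup E] [NormedSpace ℝ E]
    {O : Set (ℝ × E)} (hO : IsOpen O) {I : ℝ × E → ℝ} (hI : ContDiffOn ℝ 1 I O) {ε : ℝ} {x : E}
    (h : (ε, x) ∈ O) : HasDerivAt (fun ε => I (ε, x)) (fderiv ℝ I (ε, x) (1, 0)) ε := by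
  have h1 : HasFDerivAt I (fderiv ℝ I (ε, x)) (ε, x) :=
    (((hI (ε, x) h).contDiffAt (hO.mem_nhds h)).differentiableAt (by norm_num)).hasFDerivAt
  exact h1.comp_hasDerivAt ε ((hasDerivAt_id ε).prodMk (hasDerivAt_const ε x))

lemma hasDerivAt_setIntegral_of_contDiffOn {E : Type*} [NormedAddCommGroup E] [NormedSpace ℝ E]
    [MeasurableSpace E] [BorelSpace E] {μ : Measure E} [IsFiniteMeasureOnCompacts μ] {K U : Set E}
    (hU : IsOpen U) (hK : IsCompact K) (hKU : K ⊆ U) {I : ℝ × E → ℝ}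
    (hI : ContDiffOn ℝ 1 I (Ioo (-1 : ℝ) 1 ×ˢ U)) :
    HasDerivAt (fun ε => ∫ x in K, I (ε, x) ∂μ) (∫ x in K, fderiv ℝ I (0, x) (1, 0) ∂μ) 0 := by
  have hO : IsOpen (Ioo (-1 : ℝ) 1 ×ˢ U) := isOpen_Ioo.prod hU
  have hcont : ContinuousOn (fun q => fderiv ℝ I q (1, 0)) (Ioo (-1 : ℝ) 1 ×ˢ U) :=
    (hI.continuousOn_fderiv_of_isOpen hO le_rfl).clm_apply continuousOn_const
  -- On this compact subinterval times `K` the derivative is bounded, and a constant serves as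
  -- dominating function.
  have hIcc : Icc (-1 / 2 : ℝ) (1 / 2) ⊆ Ioo (-1 : ℝ) 1 := fun ε hε =>
    ⟨by linarith [hε.1], by linarith [hε.2]⟩
  obtain ⟨C, hC⟩ := (isCompact_Icc.prod hK).exists_bound_of_continuousOn
    (hcont.mono (prod_mono hIcc hKU))
  have hslice : ∀ {J : ℝ × E → ℝ}, ContinuousOn J (Ioo (-1 : ℝ) 1 ×ˢ U) →
      ∀ ε ∈ Ioo (-1 : ℝ) 1, IntegrableOn (fun x => J (ε, x)) K μ := fun hJ ε hε =>
    (hJ.comp (by fun_prop : ContinuousOn (fun x => (ε, x)) K)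
      fun x hx => ⟨hε, hKU hx⟩).integrableOn_compact hK
  have h0 : (0 : ℝ) ∈ Ioo (-1 : ℝ) 1 := by norm_num
  refine (hasDerivAt_integral_of_dominated_loc_of_deriv_le (μ := μ.restrict K)
    (F := fun ε x => I (ε, x)) (s := Icc (-1 / 2 : ℝ) (1 / 2))
    (F' := fun ε x => fderiv ℝ I (ε, x) (1, 0)) (bound := fun _ => C)
    (Icc_mem_nhds (by norm_num) (by norm_num)) ?_ (hslice hI.continuousOn 0 h0)
    (hslice hcont 0 h0).aestronglyMeasurable ?_ ?_ ?_).2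
  · filter_upwards [isOpen_Ioo.mem_nhds h0] with ε hε
    exact (hslice hI.continuousOn ε hε).aestronglyMeasurable
  · filter_upwards [ae_restrict_mem hK.measurableSet] with x hx ε hε using hC (ε, x) ⟨hε, hx⟩
  · exact integrableOn_const hK.measure_lt_top.ne
  · filter_upwards [ae_restrict_mem hK.measurableSet] with x hx ε hε
    exact hasDerivAt_slice_of_contDiffOn hO hI ⟨hIcc hε, hKU hx⟩

section Minimal

variable {n : ℕ} {M N : Set (Eu (n + 1))} {φ : Eu n → Eu (n + 1)} {U : Set (Eu n)}
  {k : Eu (n + 1) → Eu (n + 1)} {χ : Eu n → ℝ} {v : Eu n}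

/-- A rank-one perturbation of the identity is a transvection. It occurs as the derivative of `x + ε
χ(x) v`. -/
lemma det_id_add_smulRight (ε : ℝ) (l : Eu n →L[ℝ] ℝ) (v : Eu n) :
    (ContinuousLinearMap.id ℝ (Eu n) + ε • l.smulRight v).det = 1 + ε * l v := by
  have : ((ContinuousLinearMap.id ℝ (Eu n) + ε • l.smulRight v : Eu n →L[ℝ] Eu n) :
      Eu n →ₗ[ℝ] Eu n) = LinearMap.transvection ((ε • l : Eu n →L[ℝ] ℝ) : Eu n →ₗ[ℝ] ℝ) v := by
    ext1 w
    simp [LinearMap.transvection.apply, smul_smul]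
  rw [ContinuousLinearMap.det, this, LinearMap.transvection.det]
  simp

/-- The distortion of the variation of `k` in the direction `χ v` in a chart. -/
lemma IsDiffeo.mapDistortion_chartExtend (hM : IsClosedHypersurface M) (hk : IsDiffeo 2 M N k)
    (hφ : IsC2Param M φ U) (hχ : ContDiff ℝ ∞ χ) (hχc : HasCompactSupport χ)
    (hχU : tsupport χ ⊆ U) (hL : LipschitzWith (1 / 2) fun x => χ x • v) {ε : ℝ}
    (hε : ε ∈ Ioo (-1 : ℝ) 1) :
    mapDistortion M N (fun p => k (chartExtend φ U (fun ε x => x + ε • χ x • v) ε p)) =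
      (∫ x in tsupport χ, (volFactor (fderiv ℝ (k ∘ φ) (x + ε • χ x • v)) *
        |1 + ε * fderiv ℝ χ x v| / volFactor (fderiv ℝ φ x) - 1) ^ 2 * volFactor (fderiv ℝ φ x)) +
      ∫ p in (φ '' tsupport χ)ᶜ, (|jacobian M N k p| - 1) ^ 2 ∂(volMeasure M) := by
  set F : ℝ → Eu n → Eu n := fun ε x => x + ε • χ x • v with hF
  set K := tsupport χ
  have hKc : IsCompact K := hχc
  have hX : ContDiff ℝ 2 fun x => χ x • v :=
    (hχ.of_le (WithTop.coe_le_coe.2 (le_top : (2 : ℕ∞) ≤ ⊤))).smul contDiff_const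
  have hXK : ∀ x ∉ K, χ x • v = 0 := fun x hx => by rw [image_eq_zero_of_notMem_tsupport hx, zero_smul]
  obtain ⟨hmaps, hvar⟩ := hk.isVariation_chartExtend hφ hKc hχU hX hL hXK
  have hc := hvar.isDiffeo ε hε
  set c := fun p => k (chartExtend φ U F ε p) with hcdef
  have hclosed := hφ.isClosed_image hKc hχU
  have hFc : ContinuousOn (fun p => (|jacobian M N c p| - 1) ^ 2) M :=
    ((hc.continuousOn_abs_jacobian hM).sub continuousOn_const).pow 2
  rw [mapDistortion, ← integral_add_compl hclosed.measurableSet (hM.integrable_of_continuousOn hFc),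
    hφ.setIntegral_image hM hKc.measurableSet hχU hFc]
  congr 1
  · refine setIntegral_congr_fun hKc.measurableSet fun x hxK => ?_
    have hx := hχU hxK
    have hdF : HasFDerivAt (F ε)
        (ContinuousLinearMap.id ℝ (Eu n) + ε • (fderiv ℝ χ x).smulRight v) x :=
      (hasFDerivAt_id x).add
        ((((hχ.differentiable (by simp)) x).hasFDerivAt.smul_const v).const_smul ε)
    have hd := (((hk.comp_param hφ).differentiableAt (hmaps ε hε hx)).hasFDerivAt).comp x hdF
    have hev : c ∘ φ =ᶠ[𝓝 x] (k ∘ φ) ∘ F ε := by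
      filter_upwards [hφ.isOpen.mem_nhds hx] with y hy
      simp only [hcdef, Function.comp_apply, hφ.chartExtend_apply F ε hy]
    have hfd := (hd.congr_of_eventuallyEq hev).fderiv
    rw [hc.abs_jacobian_apply hφ hx, hfd, volFactor_comp, det_id_add_smulRight]
  · refine setIntegral_congr_ae hclosed.isOpen_compl.measurableSet ?_
    filter_upwards [mem_ae_iff.2 hM.volMeasure_compl] with p hpM hp
    have hFK : ∀ x ∈ U \ K, F ε x = x := fun x hx => by simp [F, hXK x hx.2]
    -- The Jacobian at `p` depends only on the germ of the map along `M`, and `c = k` off the closed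
    -- set `φ '' K`.
    have hev : c =ᶠ[𝓝[M] p] k := by
      filter_upwards [mem_nhdsWithin_of_mem_nhds (hclosed.isOpen_compl.mem_nhds hp)] with q hq
      simp only [hcdef, hφ.chartExtend_of_notMem hFK hq]
    have hcp : c p = k p := by simp only [hcdef, hφ.chartExtend_of_notMem hFK hp]
    have : jacobian M N c p = jacobian M N k p := by
      unfold jacobian
      rw [hev.fderivWithin_eq hcp, hcp]
    rw [this]

/-- The Euler-Lagrange equation of a distortion minimal map in a chart. -/
lemma IsDistortionMinimalMap.setIntegral_eq_zero (hM : IsClosedHypersurface M)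
    (hk : IsDistortionMinimalMap M N k) (hφ : IsC2Param M φ U) (hχ : ContDiff ℝ ∞ χ)
    (hχc : HasCompactSupport χ) (hχU : tsupport χ ⊆ U)
    (hL : LipschitzWith (1 / 2) fun x => χ x • v) :
    ∫ x in tsupport χ, 2 * (volFactor (fderiv ℝ (k ∘ φ) x) / volFactor (fderiv ℝ φ x) - 1) *
      fderiv ℝ (fun y => volFactor (fderiv ℝ (k ∘ φ) y) * χ y) x v = 0 := by
  set g : Eu n → ℝ := fun x => volFactor (fderiv ℝ (k ∘ φ) x) with hg
  set ρ : Eu n → ℝ := fun x => volFactor (fderiv ℝ φ x) with hρ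
  have hgC : ContDiffOn ℝ 1 g U := (hk.1.comp_param hφ).contDiffOn_volFactor
  have hρC : ContDiffOn ℝ 1 ρ U := hφ.contDiffOn_volFactor
  have hρ0 : ∀ x ∈ U, ρ x ≠ 0 := fun x hx => (hφ.volFactor_pos hx).ne'
  have hKc : IsCompact (tsupport χ) := hχc
  have hχ2 : ContDiff ℝ 2 χ := hχ.of_le (WithTop.coe_le_coe.2 (le_top : (2 : ℕ∞) ≤ ⊤))
  have hX : ContDiff ℝ 2 fun x => χ x • v := hχ2.smul contDiff_const
  have hXK : ∀ x ∉ tsupport χ, χ x • v = 0 := fun x hx => by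
    rw [image_eq_zero_of_notMem_tsupport hx, zero_smul]
  obtain ⟨hmaps, hvar⟩ := hk.1.isVariation_chartExtend hφ hKc hχU hX hL hXK
  have hcrit := hk.2 _ hvar
  -- The integrand without the absolute value around `1 + ε ∂ᵥχ`, so that it is `C¹`. For small `ε`
  -- this factor is nonnegative on the support and nothing changes.
  let I : ℝ × Eu n → ℝ := fun q =>
    (g (q.2 + q.1 • χ q.2 • v) * (1 + q.1 * fderiv ℝ χ q.2 v) / ρ q.2 - 1) ^ 2 * ρ q.2
  have hI : ContDiffOn ℝ 1 I (Ioo (-1 : ℝ) 1 ×ˢ U) := by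
    have h1 : ContDiffOn ℝ 1 (fun q : ℝ × Eu n => g (q.2 + q.1 • χ q.2 • v))
        (Ioo (-1 : ℝ) 1 ×ˢ U) := by
      have : ContDiff ℝ 1 (fun q : ℝ × Eu n => q.2 + q.1 • χ q.2 • v) :=
        contDiff_snd.add (contDiff_fst.smul ((hX.of_le (by norm_num)).comp contDiff_snd))
      exact hgC.comp this.contDiffOn fun q hq => hmaps _ hq.1 hq.2
    have h2 : ContDiff ℝ 1 (fun q : ℝ × Eu n => 1 + q.1 * fderiv ℝ χ q.2 v) := by
      have : ContDiff ℝ 1 (fderiv ℝ χ) := hχ2.fderiv_right (by norm_num)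
      exact contDiff_const.add (contDiff_fst.mul
        ((this.comp contDiff_snd).clm_apply contDiff_const))
    have h3 : ContDiffOn ℝ 1 (fun q : ℝ × Eu n => ρ q.2) (Ioo (-1 : ℝ) 1 ×ˢ U) :=
      hρC.comp contDiffOn_snd fun q hq => hq.2
    exact ((((h1.mul h2.contDiffOn).div h3 fun q hq => hρ0 _ hq.2).sub contDiffOn_const).pow 2).mul h3
  have hder := hasDerivAt_setIntegral_of_contDiffOn (μ := volume) hφ.isOpen hKc hχU hI
  obtain ⟨C, hC⟩ := hKc.exists_bound_of_continuousOn
    (((hχ2.continuous_fderiv (by norm_num)).clm_apply continuous_const).continuousOn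
      (s := tsupport χ) : ContinuousOn (fun x => fderiv ℝ χ x v) (tsupport χ))
  have hev : ∀ᶠ ε in 𝓝 (0 : ℝ),
      (fun ε => mapDistortion M N
        (fun p => k (chartExtend φ U (fun ε x => x + ε • χ x • v) ε p))) ε =
      (∫ x in tsupport χ, I (ε, x)) +
        ∫ p in (φ '' tsupport χ)ᶜ, (|jacobian M N k p| - 1) ^ 2 ∂(volMeasure M) := by
    have h1 : Ioo (-1 : ℝ) 1 ∈ 𝓝 (0 : ℝ) := isOpen_Ioo.mem_nhds (by norm_num)
    have h2 : ∀ᶠ ε in 𝓝 (0 : ℝ), |ε| * |C| < 1 := by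
      have : Tendsto (fun ε : ℝ => |ε| * |C|) (𝓝 0) (𝓝 (|0| * |C|)) :=
        (continuous_abs.mul continuous_const).tendsto 0
      rw [abs_zero, zero_mul] at this
      exact this.eventually_lt_const one_pos
    filter_upwards [h1, h2] with ε hε hεC
    rw [hk.1.mapDistortion_chartExtend hM hφ hχ hχc hχU hL hε]
    congr 1
    refine setIntegral_congr_fun hKc.measurableSet fun x hx => ?_
    have h3 : |ε * fderiv ℝ χ x v| < 1 := by
      rw [abs_mul]
      refine lt_of_le_of_lt (mul_le_mul_of_nonneg_left ?_ (abs_nonneg ε)) hεC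
      exact (hC x hx).trans (le_abs_self C)
    have h4 : 0 ≤ 1 + ε * fderiv ℝ χ x v := by linarith [(abs_lt.1 h3).1]
    simp only [I, abs_of_nonneg h4, hg, hρ]
  have huniq := hcrit.unique ((hder.add_const _).congr_of_eventuallyEq hev)
  rw [huniq]
  refine setIntegral_congr_fun hKc.measurableSet fun x hxK => ?_
  have hx := hχU hxK
  have hO : IsOpen (Ioo (-1 : ℝ) 1 ×ˢ U) := isOpen_Ioo.prod hφ.isOpen
  have h0 : ((0 : ℝ), x) ∈ Ioo (-1 : ℝ) 1 ×ˢ U := ⟨by norm_num, hx⟩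
  have hdI : HasDerivAt (fun ε => I (ε, x)) (fderiv ℝ I (0, x) (1, 0)) 0 :=
    hasDerivAt_slice_of_contDiffOn hO hI h0
  have hgd : HasFDerivAt g (fderiv ℝ g x) x :=
    (((hgC x hx).contDiffAt (hφ.isOpen.mem_nhds hx)).differentiableAt (by norm_num)).hasFDerivAt
  have hline : HasDerivAt (fun ε : ℝ => x + ε • χ x • v) (χ x • v) 0 := by
    simpa using ((hasDerivAt_id (0 : ℝ)).smul_const (χ x • v)).const_add x
  have hgl : HasDerivAt (fun ε : ℝ => g (x + ε • χ x • v)) (fderiv ℝ g x (χ x • v)) 0 := by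
    have hgd' : HasFDerivAt g (fderiv ℝ g x) (x + (0 : ℝ) • χ x • v) := by simpa using hgd
    exact hgd'.comp_hasDerivAt (0 : ℝ) hline
  have hdet : HasDerivAt (fun ε : ℝ => 1 + ε * fderiv ℝ χ x v) (fderiv ℝ χ x v) 0 := by
    simpa using ((hasDerivAt_id (0 : ℝ)).mul_const (fderiv ℝ χ x v)).const_add 1
  have hdI' := ((((hgl.mul hdet).div_const (ρ x)).sub_const 1).pow 2).mul_const (ρ x)
  have hχd : HasFDerivAt χ (fderiv ℝ χ x) x := (hχ2.differentiable (by norm_num) x).hasFDerivAt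
  -- At `ε = 0` the explicit derivative is `2 (g/ρ - 1) (χ ∂ᵥg + g ∂ᵥχ)`, the weight `ρ` cancelling
  -- `1/ρ`; the last factor is `∂ᵥ(g χ)`.
  have e1 := hdI.unique hdI'
  have e2 : fderiv ℝ (fun y => g y * χ y) x v = g x * fderiv ℝ χ x v + χ x * fderiv ℝ g x v := by
    have h1 : HasFDerivAt (fun y => g y * χ y) (g x • fderiv ℝ χ x + χ x • fderiv ℝ g x) x :=
      hgd.mul hχd
    rw [h1.fderiv]
    simp
  have h2 := hρ0 x hx
  change 2 * (g x / ρ x - 1) * _ = _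
  rw [e1, e2]
  simp only [Pi.mul_apply, map_smul, smul_eq_mul, zero_smul, add_zero, zero_mul, mul_one, Nat.cast_ofNat,
    Nat.add_one_sub_one, pow_one]
  generalize ρ x = r at h2 ⊢
  field_simp
  ring

end Minimal

/-! ### Integration by parts and constancy of the Jacobian. -/

section Minimal

variable {n : ℕ} {M N : Set (Eu (n + 1))} {φ : Eu n → Eu (n + 1)} {U : Set (Eu n)}
  {k : Eu (n + 1) → Eu (n + 1)}

lemma contDiff_mul_of_tsupport_subset {E : Type*} [NormedAddCommGroup E] [NormedSpace ℝ E]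
    {U : Set E} (hU : IsOpen U) {g χ : E → ℝ} {r : WithTop ℕ∞} (hg : ContDiffOn ℝ r g U)
    (hχ : ContDiff ℝ r χ) (hχU : tsupport χ ⊆ U) : ContDiff ℝ r fun x => g x * χ x := by
  refine contDiff_iff_contDiffAt.2 fun x => ?_
  by_cases hx : x ∈ U
  · exact ((hg x hx).contDiffAt (hU.mem_nhds hx)).mul hχ.contDiffAt
  · have hx' : x ∉ tsupport χ := fun h => hx (hχU h)
    refine (contDiffAt_const (c := (0 : ℝ))).congr_of_eventuallyEq ?_
    filter_upwards [notMem_tsupport_iff_eventuallyEq.1 hx'] with y hy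
    rw [hy, Pi.zero_apply, mul_zero]

/-- Integration by parts moves `∂ᵥ` from `g χ` to `g/ρ`; compact support of `χ` in `U` removes the
boundary term. -/
lemma IsDistortionMinimalMap.integral_fderiv_eq_zero (hM : IsClosedHypersurface M)
    (hk : IsDistortionMinimalMap M N k) (hφ : IsC2Param M φ U) (v : Eu n) {χ : Eu n → ℝ}
    (hχ : ContDiff ℝ ∞ χ) (hχc : HasCompactSupport χ) (hχU : tsupport χ ⊆ U) :
    ∫ x, χ x * (fderiv ℝ (fun x => volFactor (fderiv ℝ (k ∘ φ) x) / volFactor (fderiv ℝ φ x)) x v *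
      volFactor (fderiv ℝ (k ∘ φ) x)) = 0 := by
  have hkφ := hk.1.comp_param hφ
  set g : Eu n → ℝ := fun x => volFactor (fderiv ℝ (k ∘ φ) x) with hg
  set f : Eu n → ℝ := fun x => volFactor (fderiv ℝ (k ∘ φ) x) / volFactor (fderiv ℝ φ x) with hf
  have hgC : ContDiffOn ℝ 1 g U := hkφ.contDiffOn_volFactor
  have hfC : ContDiffOn ℝ 1 f U := hgC.div hφ.contDiffOn_volFactor
    fun x hx => (hφ.volFactor_pos hx).ne'
  obtain ⟨C, hC⟩ := ContDiff.lipschitzWith_of_hasCompactSupport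
    (f := fun x => χ x • v) (hχc.smul_right) (hχ.smul contDiff_const) (by simp)
  -- The variation requires Lipschitz constant `1/2`. The identity is linear in `χ`, so `χ` may be
  -- scaled down; `C + 1` avoids division by zero.
  obtain ⟨δ, hδ, hδC⟩ : ∃ δ : ℝ, 0 < δ ∧ δ * C ≤ 1 / 2 := by
    refine ⟨1 / (2 * (C + 1)), by positivity, ?_⟩
    rw [div_mul_eq_mul_div, one_mul, div_le_div_iff₀ (by positivity) (by norm_num)]
    linarith
  let ξ : Eu n → ℝ := fun x => δ * χ x
  have hξ : ContDiff ℝ ∞ ξ := contDiff_const.mul hχ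
  have hsupp : tsupport ξ ⊆ tsupport χ := closure_mono fun x hx h => hx (by simp [ξ, h])
  have hξc : HasCompactSupport ξ := hχc.mul_left
  have hξU : tsupport ξ ⊆ U := hsupp.trans hχU
  have hL : LipschitzWith (1 / 2) fun x => ξ x • v := by
    refine LipschitzWith.of_dist_le_mul fun x y => ?_
    have h1 := hC.dist_le_mul x y
    rw [dist_eq_norm] at h1 ⊢
    have h2 : ξ x • v - ξ y • v = δ • (χ x • v - χ y • v) := by
      simp only [ξ, mul_smul, smul_sub]
    rw [h2, norm_smul, Real.norm_eq_abs, abs_of_pos hδ]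
    calc δ * ‖χ x • v - χ y • v‖ ≤ δ * (C * dist x y) := by gcongr
      _ = δ * C * dist x y := by ring
      _ ≤ 1 / 2 * dist x y := by gcongr
      _ = _ := by norm_num
  have h0 := hk.setIntegral_eq_zero hM hφ hξ hξc hξU hL
  have hG : ContDiff ℝ 1 fun x => g x * ξ x :=
    contDiff_mul_of_tsupport_subset hφ.isOpen hgC (hξ.of_le (by simp)) hξU
  have hGsupp : tsupport (fun x => g x * ξ x) ⊆ tsupport ξ := tsupport_mul_subset_right
  have hGc : HasCompactSupport fun x => g x * ξ x := hξc.mul_left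
  have hGd : Continuous fun x => fderiv ℝ (fun y => g y * ξ y) x v :=
    (hG.continuous_fderiv (by norm_num)).clm_apply continuous_const
  have hGdsupp : tsupport (fun x => fderiv ℝ (fun y => g y * ξ y) x v) ⊆ tsupport ξ :=
    (tsupport_fderiv_apply_subset ℝ v).trans hGsupp
  have hint : ∀ {a b : Eu n → ℝ}, ContinuousOn a U → Continuous b → tsupport b ⊆ tsupport ξ →
      Integrable fun x => a x * b x := by
    intro a b ha hb hbs
    have h1 : Continuous fun x => a x * b x := by
      refine continuous_iff_continuousAt.2 fun x => ?_
      by_cases hx : x ∈ U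
      · exact (ha.continuousAt (hφ.isOpen.mem_nhds hx)).mul hb.continuousAt
      · have hx' : x ∉ tsupport b := fun h => hx (hξU (hbs h))
        refine (continuousAt_const (y := (0 : ℝ))).congr ?_
        filter_upwards [notMem_tsupport_iff_eventuallyEq.1 hx'] with y hy
        rw [hy, Pi.zero_apply, mul_zero]
    refine h1.integrable_of_hasCompactSupport ?_
    exact HasCompactSupport.mul_left (hξc.of_isClosed_subset (isClosed_tsupport _) hbs)
  have hfdC : ContinuousOn (fun x => fderiv ℝ f x v) U :=
    (hfC.continuousOn_fderiv_of_isOpen hφ.isOpen le_rfl).clm_apply continuousOn_const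
  -- Nothing is known about `f` outside `U`, where `χ` vanishes anyway.
  have hsub : ∀ x, fderiv ℝ (fun y => 2 * (f y - 1)) x v = 2 * fderiv ℝ f x v ∨ x ∉ U := by
    intro x
    by_cases hx : x ∈ U
    · left
      have h1 := (((hfC x hx).contDiffAt (hφ.isOpen.mem_nhds hx)).differentiableAt
        (by norm_num)).hasFDerivAt
      rw [((h1.sub_const 1).const_mul 2).fderiv]
      simp
    · exact Or.inr hx
  have hfdiff : ∀ x ∈ U, DifferentiableAt ℝ (fun y => 2 * (f y - 1)) x := fun x hx =>
    ((((hfC x hx).contDiffAt (hφ.isOpen.mem_nhds hx)).differentiableAt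
      (by norm_num)).sub_const 1).const_mul 2
  have hfderivC : ContinuousOn (fun x => fderiv ℝ (fun y => 2 * (f y - 1)) x v) U :=
    (hfdC.const_smul (2 : ℝ)).congr fun x hx => (hsub x).resolve_right (not_not.2 hx)
  have hparts := integral_mul_fderiv_eq_neg_fderiv_mul_of_integrable (μ := (volume : Measure (Eu n)))
    (f := fun x => 2 * (f x - 1)) (g := fun x => g x * ξ x) (v := v)
    (hint hfderivC hG.continuous hGsupp)
    (hint ((hfC.continuousOn.sub continuousOn_const).const_smul (2 : ℝ)) hGd hGdsupp)
    (hint ((hfC.continuousOn.sub continuousOn_const).const_smul (2 : ℝ)) hG.continuous hGsupp)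
    (fun x hx => hfdiff x (hξU (hGsupp hx))) (fun x _ => hG.differentiable (by norm_num) x)
  have hfull : ∫ x, 2 * (f x - 1) * fderiv ℝ (fun y => g y * ξ y) x v = 0 := by
    rw [← h0, setIntegral_eq_integral_of_forall_compl_eq_zero]
    intro x hx
    have : fderiv ℝ (fun y => g y * ξ y) x v = 0 :=
      image_eq_zero_of_notMem_tsupport (f := fun x => fderiv ℝ (fun y => g y * ξ y) x v)
        fun h => hx (hGdsupp h)
    exact mul_eq_zero_of_right _ this
  rw [hfull, eq_comm, neg_eq_zero] at hparts
  have hfin : ∫ x, fderiv ℝ (fun x => 2 * (f x - 1)) x v * (g x * ξ x)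
      = 2 * δ * ∫ x, χ x * (fderiv ℝ f x v * g x) := by
    rw [← integral_const_mul]
    refine integral_congr_ae (ae_of_all _ fun x => ?_)
    rcases hsub x with h | h
    · simp only [h, ξ]; ring
    · have : χ x = 0 := image_eq_zero_of_notMem_tsupport fun h' => h (hχU h')
      simp [ξ, this]
  rw [hfin] at hparts
  exact (mul_eq_zero.1 hparts).resolve_left (by positivity)

/-- The Jacobian of a distortion minimal map has constant absolute value. -/
theorem IsDistortionMinimalMap.exists_abs_jacobian_eq (hM : IsClosedHypersurface M)
    (hk : IsDistortionMinimalMap M N k) : ∃ c, ∀ p ∈ M, |jacobian M N k p| = c := by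
  have hlocal : ∀ p ∈ M, ∀ᶠ q in 𝓝[M] p, |jacobian M N k q| = |jacobian M N k p| := by
    intro p hp
    obtain ⟨φ, U, hφ, x, hx, rfl⟩ := hM.exists_isC2Param hp
    have hkφ := hk.1.comp_param hφ
    set g : Eu n → ℝ := fun x => volFactor (fderiv ℝ (k ∘ φ) x) with hg
    set f : Eu n → ℝ := fun x => volFactor (fderiv ℝ (k ∘ φ) x) / volFactor (fderiv ℝ φ x) with hf
    have hgC : ContDiffOn ℝ 1 g U := hkφ.contDiffOn_volFactor
    have hfC : ContDiffOn ℝ 1 f U := hgC.div hφ.contDiffOn_volFactor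
      fun x hx => (hφ.volFactor_pos hx).ne'
    have hzero : ∀ y ∈ U, fderiv ℝ f y = 0 := by
      intro y hy
      ext1 v
      have hcont : ContinuousOn (fun x => fderiv ℝ f x v * g x) U :=
        ((hfC.continuousOn_fderiv_of_isOpen hφ.isOpen le_rfl).clm_apply continuousOn_const).mul
          hgC.continuousOn
      -- The fundamental lemma of the calculus of variations gives vanishing almost everywhere,
      -- continuity gives it on all of `U`, and `g > 0` can be divided out.
      have hae := hφ.isOpen.ae_eq_zero_of_integral_contDiff_smul_eq_zero
        (hcont.locallyIntegrableOn (μ := volume) hφ.isOpen.measurableSet)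
        fun χ hχ hχc hχU => hk.integral_fderiv_eq_zero hM hφ v hχ hχc hχU
      have h1 := Measure.eqOn_open_of_ae_eq (f := fun x => fderiv ℝ f x v * g x) (g := fun _ => 0)
        ((ae_restrict_iff' hφ.isOpen.measurableSet).2 hae) hφ.isOpen hcont continuousOn_const hy
      exact (mul_eq_zero.1 h1).resolve_right (hkφ.volFactor_pos hy).ne'
    -- `U` need not be connected, so a ball replaces it.
    obtain ⟨r, hr, hrU⟩ := Metric.isOpen_iff.1 hφ.isOpen x hx
    have hconst : ∀ y ∈ Metric.ball x r, f y = f x := fun y hy =>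
      Metric.isOpen_ball.is_const_of_fderiv_eq_zero (convex_ball x r).isPreconnected
        ((hfC.differentiableOn (by norm_num)).mono hrU) (fun z hz => hzero z (hrU hz)) hy
        (Metric.mem_ball_self hr)
    filter_upwards [hφ.image_mem_nhdsWithin (Metric.ball_mem_nhds x hr) hx]
    rintro _ ⟨y, hy, rfl⟩
    rw [hk.1.abs_jacobian_apply hφ (hrU hy), hk.1.abs_jacobian_apply hφ hx]
    exact hconst y hy
  obtain ⟨p₀, hp₀⟩ := hM.isConnected.nonempty
  refine ⟨|jacobian M N k p₀|, fun p hp => ?_⟩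
  have : PreconnectedSpace M := isPreconnected_iff_preconnectedSpace.1 hM.isConnected.isPreconnected
  have hlc : IsLocallyConstant fun p : M => |jacobian M N k p| := by
    refine (IsLocallyConstant.iff_eventually_eq _).2 fun p => ?_
    have := hlocal p p.2
    rw [nhdsWithin_eq_map_subtype_coe p.2] at this
    exact this
  exact hlc.apply_eq_of_preconnectedSpace ⟨p, hp⟩ ⟨p₀, hp₀⟩

end Minimal

/-! ### Pairwise minimal morphs -/

section Morph

variable {n : ℕ} {M N : Set (Eu (n + 1))} {H : ℝ → Eu (n + 1) → Eu (n + 1)}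

lemma IsDiffeo.injOn {r : WithTop ℕ∞} {k : Eu (n + 1) → Eu (n + 1)} (h : IsDiffeo r M N k) :
    InjOn k M := by
  obtain ⟨-, -, g, -, -, hinv⟩ := h
  exact hinv.1.injOn

lemma IsMorph.transition_apply (hH : IsMorph 2 M N H) {s : ℝ} (hs : s ∈ Icc (0 : ℝ) 1) (t : ℝ)
    {p : Eu (n + 1)} (hp : p ∈ M) : transition M H s t (H s p) = H t p := by
  rw [transition, (hH.isDiffeo s hs).injOn.leftInvOn_invFunOn hp]

lemma IsMorph.abs_jacobian_transition (hH : IsMorph 2 M N H) (hmin : IsPairwiseMinimal M H)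
    {s t : ℝ} (hs : s ∈ Icc (0 : ℝ) 1) (ht : t ∈ Icc (0 : ℝ) 1) {q : Eu (n + 1)}
    (hq : q ∈ H s '' M) : |jacobian (H s '' M) (H t '' M) (transition M H s t) q|
      = Vol (H t '' M) / Vol (H s '' M) := by
  obtain ⟨c, hc⟩ := (hmin s hs t ht).exists_abs_jacobian_eq (hH.isClosedHypersurface s hs)
  rw [hc q hq]
  exact ((hmin s hs t ht).1.mapDistortion_of_const (hH.isClosedHypersurface s hs)
    (hH.isClosedHypersurface t ht) hc).1

lemma IsMorph.transitionDistortion_eq (hH : IsMorph 2 M N H) (hmin : IsPairwiseMinimal M H)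
    {s t : ℝ} (hs : s ∈ Icc (0 : ℝ) 1) (ht : t ∈ Icc (0 : ℝ) 1) : transitionDistortion M H s t
      = (Vol (H t '' M) - Vol (H s '' M)) ^ 2 / Vol (H s '' M) := by
  obtain ⟨c, hc⟩ := (hmin s hs t ht).exists_abs_jacobian_eq (hH.isClosedHypersurface s hs)
  exact ((hmin s hs t ht).1.mapDistortion_of_const (hH.isClosedHypersurface s hs)
    (hH.isClosedHypersurface t ht) hc).2

lemma IsMorph.Vol_pos (hH : IsMorph 2 M N H) {t : ℝ} (ht : t ∈ Icc (0 : ℝ) 1) :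
    0 < Vol (H t '' M) := (hH.isClosedHypersurface t ht).Vol_pos

/-- The transition map from time `0` to `t` takes the chart `H 0 ∘ φ` to `H t ∘ φ`, and its Jacobian
is the ratio of volumes. Hence the volume can be read off from the density at one point. -/
lemma IsMorph.volFactor_eq (hH : IsMorph 2 M N H) (hmin : IsPairwiseMinimal M H)
    {φ : Eu n → Eu (n + 1)} {U : Set (Eu n)} (hφ : IsC2Param M φ U) {x : Eu n} (hx : x ∈ U) {t : ℝ}
    (ht : t ∈ Icc (0 : ℝ) 1) : volFactor (fderiv ℝ (H t ∘ φ) x)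
      = Vol (H t '' M) / Vol (H 0 '' M) * volFactor (fderiv ℝ (H 0 ∘ φ) x) := by
  have h0 : (0 : ℝ) ∈ Icc (0 : ℝ) 1 := by norm_num
  have hφ0 := (hH.isDiffeo 0 h0).comp_param hφ
  have h1 := (hmin 0 h0 t ht).1.abs_jacobian_apply hφ0 hx
  rw [hH.abs_jacobian_transition hmin h0 ht (hφ0.mapsTo hx)] at h1
  have hev : transition M H 0 t ∘ (H 0 ∘ φ) =ᶠ[𝓝 x] H t ∘ φ := by
    filter_upwards [hφ.isOpen.mem_nhds hx] with y hy
    exact hH.transition_apply h0 t (hφ.mapsTo hy)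
  rw [hev.fderiv_eq] at h1
  rw [h1, div_mul_cancel₀ _ (hφ0.volFactor_pos hx).ne']

/-- No integral is differentiated: by `volFactor_eq` the volume is a fixed multiple of the density
at a single `x`, which is `C¹` in `t` because `H` is `C²` and `volFactor` is smooth at injective
maps. -/
lemma IsMorph.contDiffOn_Vol (hM : IsClosedHypersurface M) (hH : IsMorph 2 M N H)
    (hmin : IsPairwiseMinimal M H) :
    ContDiffOn ℝ 1 (fun t => Vol (H t '' M)) (Icc (0 : ℝ) 1) := by
  have h0 : (0 : ℝ) ∈ Icc (0 : ℝ) 1 := by norm_num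
  obtain ⟨p, hp⟩ := hM.isConnected.nonempty
  obtain ⟨φ, U, hφ, x, hx, -⟩ := hM.exists_isC2Param hp
  have hpos : 0 < volFactor (fderiv ℝ (H 0 ∘ φ) x) :=
    ((hH.isDiffeo 0 h0).comp_param hφ).volFactor_pos hx
  have hV0 := hH.Vol_pos h0
  let K : ℝ × Eu n → Eu (n + 1) := fun q => H q.1 (φ q.2)
  have hK : ContDiffOn ℝ 2 K (Icc (0 : ℝ) 1 ×ˢ U) :=
    hH.contDiffOn.comp (contDiffOn_fst.prodMk (hφ.contDiffOn.comp contDiffOn_snd fun q hq => hq.2))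
      fun q hq => ⟨hq.1, hφ.mapsTo hq.2⟩
  -- Since `H` is controlled only for `t` in `[0,1]`, the space derivative is obtained by
  -- restricting the derivative within `[0,1] × U` to the vectors `(0, v)`.
  have hK' := hK.fderivWithin (m := 1)
    ((uniqueDiffOn_Icc zero_lt_one).prod hφ.isOpen.uniqueDiffOn) (by norm_num)
  have hcomp : ContDiffOn ℝ 1 (fun t => (fderivWithin ℝ K (Icc (0 : ℝ) 1 ×ˢ U) (t, x)).comp
      (ContinuousLinearMap.inr ℝ ℝ (Eu n))) (Icc (0 : ℝ) 1) :=
    (hK'.comp (contDiff_id.prodMk contDiff_const).contDiffOn fun t ht => ⟨ht, hx⟩).clm_comp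
      contDiffOn_const
  have heq : ∀ t ∈ Icc (0 : ℝ) 1, fderiv ℝ (H t ∘ φ) x =
      (fderivWithin ℝ K (Icc (0 : ℝ) 1 ×ˢ U) (t, x)).comp (ContinuousLinearMap.inr ℝ ℝ (Eu n)) := by
    intro t ht
    have h1 := (hK.differentiableOn (by norm_num) (t, x) ⟨ht, hx⟩).hasFDerivWithinAt
    have h2 : HasFDerivAt (fun y : Eu n => (t, y)) (ContinuousLinearMap.inr ℝ ℝ (Eu n)) x :=
      hasFDerivAt_prodMk_right t x
    exact (h1.comp_hasFDerivAt x h2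
      (by filter_upwards [hφ.isOpen.mem_nhds hx] with y hy using ⟨ht, hy⟩)).fderiv
  have hG : ContDiffOn ℝ 1 (fun t => volFactor (fderiv ℝ (H t ∘ φ) x)) (Icc (0 : ℝ) 1) := by
    have h1 := hcomp.congr heq
    intro t ht
    exact ContDiffAt.comp_contDiffWithinAt (g := volFactor) t
      (contDiffAt_volFactor (((hH.isDiffeo t ht).comp_param hφ).immersion x hx)) (h1 t ht)
  refine (contDiffOn_const (c := Vol (H 0 '' M) / volFactor (fderiv ℝ (H 0 ∘ φ) x)) |>.mul
    hG).congr fun t ht => ?_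
  rw [hH.volFactor_eq hmin hφ hx ht]
  field_simp

/-- The map `h^0` need not be the identity or have constant Jacobian, so `|J(h^0)|` remains as a
factor independent of `t`. -/
lemma IsMorph.abs_jacobian_eq (hM : IsClosedHypersurface M) (hH : IsMorph 2 M N H)
    (hmin : IsPairwiseMinimal M H) {p : Eu (n + 1)} (hp : p ∈ M) {t : ℝ}
    (ht : t ∈ Icc (0 : ℝ) 1) : |jacobian M (H t '' M) (H t) p|
      = |jacobian M (H 0 '' M) (H 0) p| / Vol (H 0 '' M) * Vol (H t '' M) := by
  have h0 : (0 : ℝ) ∈ Icc (0 : ℝ) 1 := by norm_num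
  obtain ⟨φ, U, hφ, x, hx, rfl⟩ := hM.exists_isC2Param hp
  rw [(hH.isDiffeo t ht).abs_jacobian_apply hφ hx, (hH.isDiffeo 0 h0).abs_jacobian_apply hφ hx,
    hH.volFactor_eq hmin hφ hx ht]
  ring

/-- The quotient is the squared slope of the volume between `s` and `t`, divided by the volume at
time `s`; the latter converges by continuity. -/
lemma IsMorph.tendsto_transitionDistortion (hM : IsClosedHypersurface M) (hH : IsMorph 2 M N H)
    (hmin : IsPairwiseMinimal M H) {t : ℝ} (ht : t ∈ Icc (0 : ℝ) 1) :
    Tendsto (fun s => transitionDistortion M H s t / (s - t) ^ 2) (𝓝[Icc (0 : ℝ) 1 \ {t}] t)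
      (𝓝 (derivWithin (fun τ => Vol (H τ '' M)) (Icc (0 : ℝ) 1) t ^ 2 / Vol (H t '' M))) := by
  have hV := hH.contDiffOn_Vol hM hmin
  have hd := (hV.differentiableOn (by norm_num) t ht).hasDerivWithinAt
  have h1 := hasDerivWithinAt_iff_tendsto_slope.1 hd
  have h2 : Tendsto (fun s => Vol (H s '' M)) (𝓝[Icc (0 : ℝ) 1 \ {t}] t) (𝓝 (Vol (H t '' M))) :=
    (hV.continuousOn t ht).mono_left (nhdsWithin_mono _ sdiff_subset)
  refine ((h1.pow 2).div h2 (hH.Vol_pos ht).ne').congr' ?_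
  filter_upwards [self_mem_nhdsWithin] with s hs
  have hst : s - t ≠ 0 := sub_ne_zero.2 hs.2
  have hVs := (hH.Vol_pos hs.1).ne'
  rw [hH.transitionDistortion_eq hmin hs.1 ht, Pi.div_apply]
  simp only [slope_def_field]
  field_simp
  ring

lemma IsMorph.infinitesimalDistortion_eq (hM : IsClosedHypersurface M) (hH : IsMorph 2 M N H)
    (hmin : IsPairwiseMinimal M H) {t : ℝ} (ht : t ∈ Icc (0 : ℝ) 1) :
    infinitesimalDistortion M H t =
      derivWithin (fun τ => Vol (H τ '' M)) (Icc (0 : ℝ) 1) t ^ 2 / Vol (H t '' M) := by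
  -- Without this, limits along the filter would not be unique and `limUnder` would carry no
  -- information.
  have : (𝓝[Icc (0 : ℝ) 1 \ {t}] t).NeBot := accPt_principal_iff_nhdsWithin.1
    (uniqueDiffWithinAt_iff_accPt.1 (uniqueDiffOn_Icc zero_lt_one t ht))
  exact (hH.tendsto_transitionDistortion hM hmin ht).limUnder_eq

/-- With `a = |J(h^0)|` and `|J(h^t)| = a V(t) / V(0)`, the integrand is `a V'² / (V(0) V)`, and `a`
integrates to `V(0)`. -/
lemma IsMorph.integral_jacobian_eq (hM : IsClosedHypersurface M) (hH : IsMorph 2 M N H)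
    (hmin : IsPairwiseMinimal M H) {t : ℝ} (ht : t ∈ Icc (0 : ℝ) 1) :
    ∫ p, (derivWithin (fun τ => |jacobian M (H τ '' M) (H τ) p|) (Icc (0 : ℝ) 1) t) ^ 2 /
        |jacobian M (H t '' M) (H t) p| ∂(volMeasure M) =
      derivWithin (fun τ => Vol (H τ '' M)) (Icc (0 : ℝ) 1) t ^ 2 / Vol (H t '' M) := by
  have h0 : (0 : ℝ) ∈ Icc (0 : ℝ) 1 := by norm_num
  have hV0 := (hH.Vol_pos h0).ne'
  have hVt := (hH.Vol_pos ht).ne'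
  have hd : DifferentiableWithinAt ℝ (fun τ => Vol (H τ '' M)) (Icc (0 : ℝ) 1) t :=
    (hH.contDiffOn_Vol hM hmin).differentiableOn (by norm_num) t ht
  rw [hM.integral_congr (G := fun p => derivWithin (fun τ => Vol (H τ '' M)) (Icc (0 : ℝ) 1) t ^ 2 /
    (Vol (H 0 '' M) * Vol (H t '' M)) * |jacobian M (H 0 '' M) (H 0) p|), integral_const_mul,
    ← (hH.isDiffeo 0 h0).Vol_eq_integral hM (hH.isClosedHypersurface 0 h0)]
  · field_simp
  · intro p hp
    have ha := ((hH.isDiffeo 0 h0).abs_jacobian_pos hM hp).ne'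
    simp only
    rw [derivWithin_congr (fun τ hτ => hH.abs_jacobian_eq hM hmin hp hτ)
      (hH.abs_jacobian_eq hM hmin hp ht), derivWithin_const_mul _ hd,
      hH.abs_jacobian_eq hM hmin hp ht]
    field_simp

lemma IsMorph.continuousOn_infinitesimalDistortion (hM : IsClosedHypersurface M)
    (hH : IsMorph 2 M N H) (hmin : IsPairwiseMinimal M H) :
    ContinuousOn (infinitesimalDistortion M H) (Icc (0 : ℝ) 1) := by
  have hV := hH.contDiffOn_Vol hM hmin
  exact (((hV.continuousOn_derivWithin (uniqueDiffOn_Icc zero_lt_one) le_rfl).pow 2).div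
    hV.continuousOn fun t ht => (hH.Vol_pos ht).ne').congr
    fun t ht => hH.infinitesimalDistortion_eq hM hmin ht

end Morph

end Morphing

end

theorem mainTheorem11 {n : ℕ} (M N : Set (Morphing.Eu (n + 1)))
    (hM : Morphing.IsClosedHypersurface M) (hN : Morphing.IsClosedHypersurface N)
    (H : ℝ → Morphing.Eu (n + 1) → Morphing.Eu (n + 1))
    (hH : Morphing.IsMorph 2 M N H) (hmin : Morphing.IsPairwiseMinimal M H) :
    -- the infinitesimal distortion is a genuine limit, and has its usual integral expression
    (∀ t ∈ Icc (0 : ℝ) 1,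
      Tendsto (fun s => Morphing.transitionDistortion M H s t / (s - t) ^ 2)
        (𝓝[Icc (0 : ℝ) 1 \ {t}] t) (𝓝 (Morphing.infinitesimalDistortion M H t)) ∧
      Morphing.infinitesimalDistortion M H t =
        ∫ p, (derivWithin (fun τ => |Morphing.jacobian M (H τ '' M) (H τ) p|)
            (Icc (0 : ℝ) 1) t) ^ 2 / |Morphing.jacobian M (H t '' M) (H t) p|
          ∂(Morphing.volMeasure M)) ∧
    IntervalIntegrable (Morphing.infinitesimalDistortion M H) volume 0 1 ∧
    -- the right-hand side of the formula is a genuine integral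
    ContDiffOn ℝ 1 (fun t => Morphing.Vol (H t '' M)) (Icc (0 : ℝ) 1) ∧
    (∀ t ∈ Icc (0 : ℝ) 1, 0 < Morphing.Vol (H t '' M)) ∧
    Morphing.totalDistortion M H =
      ∫ t in (0 : ℝ)..1,
        (derivWithin (fun τ => Morphing.Vol (H τ '' M)) (Icc (0 : ℝ) 1) t) ^ 2 /
          Morphing.Vol (H t '' M) := by
  have huIcc : uIcc (0 : ℝ) 1 = Icc 0 1 := uIcc_of_le zero_le_one
  refine ⟨fun t ht => ⟨?_, ?_⟩, ?_, hH.contDiffOn_Vol hM hmin, fun t ht => hH.Vol_pos ht, ?_⟩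
  · rw [hH.infinitesimalDistortion_eq hM hmin ht]
    exact hH.tendsto_transitionDistortion hM hmin ht
  · rw [hH.infinitesimalDistortion_eq hM hmin ht, hH.integral_jacobian_eq hM hmin ht]
  · refine ContinuousOn.intervalIntegrable ?_
    rw [huIcc]
    exact hH.continuousOn_infinitesimalDistortion hM hmin
  · refine intervalIntegral.integral_congr fun t ht => ?_
    rw [huIcc] at ht
    exact hH.infinitesimalDistortion_eq hM hmin ht
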